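/- For $a,b\in\mathbb{R}^2$ write $\|a-b\|=(a-b)\cdot(a-b)=(a_1-b_1)^2+(a_2-b_2)^2$, and for $a\neq b$ let $\mathcal{B}(a,b)=\{x\in\mathbb{R}^2:\|a-x\|=\|b-x\|\}$ be the perpendicular bisector of $a$ and $b$. For $a,c\in\mathbb{R}^2$ let $$S_{ac}=\{(b,d): a\neq b,\ c\neq d,\ \mathcal{B}(a,b)=\mathcal{B}(c,d)\}\cup\{(a,d): d\neq c,\ a\in\mathcal{B}(c,d)\}\cup\{(b,c): b\neq a,\ c\in\mathcal{B}(a,b)\}\subset\mathbb{R}^2\times\mathbb{R}^2 .$$ For $A\subseteq\mathbb{R}^2$ and a real number $r\neq 0$ put $$\Pi_r=\{(b,d)\in A\times A:\|b-d\|=r\},\qquad \mathcal{S}_r=\{S_{ac}: a,c\in A,\ \|a-c\|=r\}.$$ For an integer $M\geq 0$ and finite sets $P\subseteq\Pi_r$, $V\subseteq\mathcal{S}_r$, let $I_M(P,V)$ be the number of incidences $((b,d),S_{ac})$ with $(b,d)\in P$, $S_{ac}\in V$ (where $a,c\in A$, $\|a-c\|=r$) and $(b,d)\in S_{ac}$,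 such that $a\neq b$ and no line or circle (of positive radius) containing both $a$ and $b$ contains more than $M$ points of $A$. **Proposition.** There is an absolute constant $C>0$ such that for all $A\subseteq\mathbb{R}^2$, all real $r\neq0$, all integers $M\geq0$, and all finite $P\subseteq\Pi_r$ and $V\subseteq\mathcal{S}_r$, $$I_M(P,V)\leq C\left(M|P|+|P|^{3/2}+|P|^{1/2}|V|\right).$$ -/

import Mathlib

namespace BisectorIncidence

/-- The real plane. -/
abbrev Plane : Type := EuclideanSpace ℝ (Fin 2)

/-- The algebraic distance `(a - b) · (a - b)`, i.e. the squared Euclidean distance. -/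
noncomputable def algDist (a b : Plane) : ℝ := inner ℝ (a - b) (a - b)

/-- The perpendicular bisector of `a` and `b`. It is only meaningful for `a ≠ b`,
and every use below is guarded by that condition. -/
def bisector (a b : Plane) : Set Plane := {x | algDist a x = algDist b x}

/-- The variety `S_{ac}`: all `(b, d)` such that `a, b` and `c, d` have a common perpendicular
bisector, together with the degenerate pairs `(a, d)` with `a` on the bisector of `c, d`, and
`(b, c)` with `c` on the bisector of `a, b`. -/
def variety (a c : Plane) : Set (Plane × Plane) :=
  {x | a ≠ x.1 ∧ c ≠ x.2 ∧ bisector a x.1 = bisector c x.2} ∪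
  {x | x.1 = a ∧ c ≠ x.2 ∧ a ∈ bisector c x.2} ∪
  {x | x.2 = c ∧ a ≠ x.1 ∧ c ∈ bisector a x.1}

/-- `Π_r`: ordered pairs of points of `A` at algebraic distance `r`. -/
def pairsAt (A : Set Plane) (r : ℝ) : Set (Plane × Plane) :=
  {x | x.1 ∈ A ∧ x.2 ∈ A ∧ algDist x.1 x.2 = r}

/-- `𝒮_r`: the varieties `S_{ac}` with `a, c ∈ A` at algebraic distance `r`. -/
def varietiesAt (A : Set Plane) (r : ℝ) : Set (Set (Plane × Plane)) :=
  {S | ∃ a ∈ A, ∃ c ∈ A, algDist a c = r ∧ S = variety a c}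

/-- Lines: one-dimensional affine subspaces of the plane. -/
def IsLine (Γ : Set Plane) : Prop :=
  ∃ L : AffineSubspace ℝ Plane, Module.finrank ℝ L.direction = 1 ∧ Γ = (L : Set Plane)

/-- Circles of positive radius. -/
def IsCircle (Γ : Set Plane) : Prop :=
  ∃ (p : Plane) (ρ : ℝ), 0 < ρ ∧ Γ = Metric.sphere p ρ

/-- Some line or circle containing both `a` and `b` contains more than `M` points of `A`. -/
def OnRichCurve (A : Set Plane) (M : ℕ) (a b : Plane) : Prop :=
  ∃ Γ : Set Plane, (IsLine Γ ∨ IsCircle Γ) ∧ a ∈ Γ ∧ b ∈ Γ ∧ (M : ℕ∞) < (Γ ∩ A).encard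

/-- The incidences `((b, d), S_{ac})` counted by `I_M(P, V)`: those for which `a` and `b` are
two distinct points that do not lie on a common line or circle with more than `M` points
of `A`. -/
def incidences (A : Set Plane) (r : ℝ) (M : ℕ)
    (P : Set (Plane × Plane)) (V : Set (Set (Plane × Plane))) :
    Set ((Plane × Plane) × Set (Plane × Plane)) :=
  {i | i.1 ∈ P ∧ i.2 ∈ V ∧ i.1 ∈ i.2 ∧
    ∃ a ∈ A, ∃ c ∈ A, algDist a c = r ∧ i.2 = variety a c ∧
      a ≠ i.1.1 ∧ ¬ OnRichCurve A M a i.1.1}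

/-- `I_M(P, V)`; for finite `P` and `V` the set of incidences is finite, as a subset
of `P ×ˢ V`. -/
noncomputable def incidenceCount (A : Set Plane) (r : ℝ) (M : ℕ)
    (P : Set (Plane × Plane)) (V : Set (Set (Plane × Plane))) : ℕ :=
  (incidences A r M P V).ncard

end BisectorIncidence

/-! If `(b, d)` lies on `S_{ac}` and `a ≠ b`, then `d` is the mirror image of `c` in the bisector of
`a` and `b`, here called the axis of the incidence. Two pairs incident to the same `S_{ac}`, with
axes meeting at `o`, differ by a product of two reflections, that is, by a rotation about `o` (a
translation if the axes are parallel and `o` is at infinity). As `r ≠ 0`, two distinct pairs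
determine the centre of such a motion (`eq_of_key_eq`). So the orbits cut out on `P` by rotations
behave like lines: two different ones share at most one pair.

Fix `s` of order `|P|^{1/2}` with `2|P| ≤ s²`. An incidence is rich if some `o` on its axis gives
its pair an orbit of at least `s` pairs. By Cauchy–Schwarz (`sum_card_le_of_pairwise_inter`) the
sizes of the rich orbits sum to at most `2|P|`. Given an orbit and a pair `(b, d)` in it, the
possible `a` lie on one line or circle through `b`, so there are at most `M`. Hence there are at
most `2M|P|` rich incidences.

For poor incidences, fix a variety `v` and the set `G` of its incident pairs. At most `s` of their
axes are concurrent or parallel, so if `|G|` is a large multiple of `s`, a theorem of Beck type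
(`sq_card_le_mul_sum_degree`, from the crossing lemma and Szemerédi–Trotter) gives at least a
constant times `|G|²` incidences between axes and their intersection points. Conversely, fix a pair
`p`: each such point on an axis of `p` is the centre of a motion taking `p` to another pair of `P`,
so at most `|P|` points occur, and the axes of `p` for different `v` are different lines.
Cauchy–Schwarz again bounds the contribution of the axes with at least `s` points by `2|P|`. Summing
over `p`, the varieties with large `G` have at most `|P|s` poor incidences in all; each other
variety has `O(s)`. -/

namespace BisectorIncidence

open Finset

/-! ### Plane straight-line graphs -/

/-- A segment given by its left and right endpoints. -/
abbrev Edge : Type := (ℝ × ℝ) × (ℝ × ℝ)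

noncomputable def slope (e : Edge) : ℝ := (e.2.2 - e.1.2) / (e.2.1 - e.1.1)

/-- The height at abscissa `x` of the line spanned by the segment `e`. -/
noncomputable def height (e : Edge) (x : ℝ) : ℝ := e.1.2 + slope e * (x - e.1.1)

lemma height_left (e : Edge) : height e e.1.1 = e.1.2 := by simp [height]

lemma height_right {e : Edge} (h : e.1.1 < e.2.1) : height e e.2.1 = e.2.2 := by
  have : e.2.1 - e.1.1 ≠ 0 := (sub_pos.mpr h).ne'
  simp only [height, slope]
  field_simp
  ring

lemma height_eq (e : Edge) (x y : ℝ) : height e x = height e y + slope e * (x - y) := by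
  simp only [height]; ring

lemma exists_height_eq {e f : Edge} {y z : ℝ} (hyz : y < z)
    (h : (height f y < height e y ∧ height e z < height f z) ∨
      (height e y < height f y ∧ height f z < height e z)) :
    ∃ x, y < x ∧ x < z ∧ height e x = height f x := by
  have key : ∀ {e f : Edge}, height f y < height e y → height e z < height f z →
      ∃ x, y < x ∧ x < z ∧ height e x = height f x := by
    intro e f h1 h2
    have he := height_eq e z y
    have hf := height_eq f z y
    have hD : 0 < (slope f - slope e) * (z - y) := by linarith
    have hs : 0 < slope f - slope e := by
      by_contra hs
      nlinarith
    refine ⟨y + (height e y - height f y) / (slope f - slope e), ?_, ?_, ?_⟩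
    · have : 0 < (height e y - height f y) / (slope f - slope e) :=
        div_pos (by linarith) hs
      linarith
    · have : (height e y - height f y) / (slope f - slope e) < z - y := by
        rw [div_lt_iff₀ hs]; linarith
      linarith
    · rw [height_eq e (y + _) y, height_eq f (y + _) y, add_sub_cancel_left]
      field_simp
      ring
  rcases h with ⟨h1, h2⟩ | ⟨h1, h2⟩
  · exact key h1 h2
  · obtain ⟨x, a, b, c⟩ := key h1 h2
    exact ⟨x, a, b, c.symm⟩

/-- A finite straight-line graph, possibly with crossings, whose vertices have distinct abscissas
and do not lie inside edges. -/
structure IsGeomGraph (N : Finset (ℝ × ℝ)) (E : Finset Edge) : Prop where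
  inj : ∀ p ∈ N, ∀ q ∈ N, p.1 = q.1 → p = q
  left_mem : ∀ e ∈ E, e.1 ∈ N
  right_mem : ∀ e ∈ E, e.2 ∈ N
  lt : ∀ e ∈ E, e.1.1 < e.2.1
  avoid : ∀ e ∈ E, ∀ b ∈ N, e.1.1 < b.1 → b.1 < e.2.1 → height e b.1 ≠ b.2

def Crosses (e f : Edge) : Prop :=
  e ≠ f ∧ ∃ x, (e.1.1 < x ∧ x < e.2.1) ∧ (f.1.1 < x ∧ x < f.2.1) ∧ height e x = height f x

/-- `e` is the highest edge starting at its left endpoint. -/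
def TopOut (E : Finset Edge) (e : Edge) : Prop := ∀ f ∈ E, f.1 = e.1 → slope f ≤ slope e

/-- `e` is the highest edge ending at its right endpoint. -/
def TopIn (E : Finset Edge) (e : Edge) : Prop := ∀ f ∈ E, f.2 = e.2 → slope e ≤ slope f

/-- `e` is the first edge met when going down from the point `b`. -/
def FirstBelow (E : Finset Edge) (e : Edge) (b : ℝ × ℝ) : Prop :=
  e.1.1 < b.1 ∧ b.1 < e.2.1 ∧ height e b.1 < b.2 ∧
    ∀ g ∈ E, g.1.1 < b.1 → b.1 < g.2.1 → height g b.1 < b.2 → height g b.1 ≤ height e b.1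

section Noncrossing

variable {N : Finset (ℝ × ℝ)} {E : Finset Edge}

lemma height_le_of_not_crosses {e f : Edge} (hef : ¬ Crosses e f) {y z : ℝ}
    (hyz : y < z) (he : e.1.1 ≤ y) (hf : f.1.1 ≤ y) (he' : z ≤ e.2.1) (hf' : z ≤ f.2.1)
    (h : height e z < height f z) : height e y ≤ height f y := by
  by_contra hlt
  push Not at hlt
  obtain ⟨x, h1, h2, h3⟩ := exists_height_eq hyz (Or.inl ⟨hlt, h⟩)
  refine hef ⟨?_, x, ⟨by linarith, by linarith⟩, ⟨by linarith, by linarith⟩, h3⟩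
  rintro rfl
  exact lt_irrefl _ h

/-- Let `f` be the next edge above `e` at its left endpoint. The leftmost vertex `b` in the wedge
between `e` and `f` works: an edge separating `b` from `e`, followed to the left, would start in the
wedge before `b`, or start between `e` and `f` at their common endpoint, or run through that
endpoint. -/
lemma firstBelow_of_not_top (hG : IsGeomGraph N E) (hX : ∀ e ∈ E, ∀ f ∈ E, ¬ Crosses e f)
    {e : Edge} (he : e ∈ E) (hout : ¬ TopOut E e) (hin : ¬ TopIn E e) :
    ∃ b ∈ N, FirstBelow E e b := by
  classical
  have hel := hG.lt e he
  obtain ⟨f, hf, hfmin⟩ := (E.filter (fun f => f.1 = e.1 ∧ slope e < slope f)).exists_min_image slope (by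
    simp only [TopOut] at hout
    push Not at hout
    obtain ⟨f, h1, h2, h3⟩ := hout
    exact ⟨f, by simp [h1, h2, h3]⟩)
  simp only [mem_filter] at hf hfmin
  obtain ⟨hfE, hf1, hfs⟩ := hf
  have hfl := hG.lt f hfE
  have hfgt : ∀ x, e.1.1 < x → height e x < height f x := by
    intro x hx
    simp only [height, hf1]
    nlinarith
  -- The wedge is not empty: if `f` ends before `e`, it contains the right end of `f`; otherwise it
  -- contains the left end of an edge `g` lying above `e` at the right endpoint of `e`.
  set T := N.filter (fun b => e.1.1 < b.1 ∧ b.1 < e.2.1 ∧ b.1 ≤ f.2.1 ∧ height e b.1 < b.2 ∧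
    b.2 ≤ height f b.1) with hT
  rcases T.eq_empty_or_nonempty with hTe | hTn
  · exfalso
    have hTmem : ∀ b ∈ N, e.1.1 < b.1 → b.1 < e.2.1 → b.1 ≤ f.2.1 → height e b.1 < b.2 →
        b.2 ≤ height f b.1 → False := by
      intro b h0 h1 h2 h3 h4 h5
      have : b ∈ T := by simp [hT, h0, h1, h2, h3, h4, h5]
      simp [hTe] at this
    have hf1' : f.1.1 = e.1.1 := by rw [hf1]
    rcases lt_trichotomy f.2.1 e.2.1 with hlt | heq | hgt
    · refine hTmem f.2 (hG.right_mem f hfE) (by linarith) hlt le_rfl ?_ ?_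
      · rw [← height_right hfl]; exact hfgt _ (by linarith)
      · rw [height_right hfl]
    · have h2 : f.2 = e.2 := hG.inj _ (hG.right_mem f hfE) _ (hG.right_mem e he) heq
      have : f = e := Prod.ext hf1 h2
      rw [this] at hfs
      exact lt_irrefl _ hfs
    · simp only [TopIn] at hin
      push Not at hin
      obtain ⟨g, hgE, hg2, hgs⟩ := hin
      have hgl := hG.lt g hgE
      have hg2' : g.2.1 = e.2.1 := by rw [hg2]
      have hgw : height g e.2.1 = height e e.2.1 := by
        rw [height_right hel, ← hg2', height_right hgl, hg2]
      have hgt' : ∀ x, x < e.2.1 → height e x < height g x := by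
        intro x hx
        rw [height_eq e x e.2.1, height_eq g x e.2.1, hgw]
        nlinarith
      have hgf : height g e.2.1 < height f e.2.1 := by rw [hgw]; exact hfgt _ hel
      rcases lt_trichotomy g.1.1 e.1.1 with hlt | heq | hgt2
      · have h1 := hgt' _ hel
        have h2 := height_le_of_not_crosses (hX g hgE f hfE) hel hlt.le hf1'.le hg2'.ge hgt.le hgf
        have h3 := height_left f
        rw [hf1'] at h3
        rw [h3, hf1] at h2
        rw [height_left] at h1
        linarith
      · have h2 : g.1 = e.1 := hG.inj _ (hG.left_mem g hgE) _ (hG.left_mem e he) heq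
        have : g = e := Prod.ext h2 hg2
        rw [this] at hgs
        exact lt_irrefl _ hgs
      · refine hTmem g.1 (hG.left_mem g hgE) hgt2 (by linarith) (by linarith) ?_ ?_
        · rw [← height_left g]; exact hgt' _ (by linarith)
        · rw [← height_left g]
          exact height_le_of_not_crosses (hX g hgE f hfE) (by linarith) le_rfl (by linarith) hg2'.ge
            hgt.le hgf
  · obtain ⟨b, hbT, hbmin⟩ := T.exists_min_image (fun b => b.1) hTn
    simp only [hT, mem_filter] at hbT hbmin
    obtain ⟨hbN, hb1, hb2, hb3, hb4, hb5⟩ := hbT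
    refine ⟨b, hbN, hb1, hb2, hb4, ?_⟩
    intro g hgE hg1 hg2 hg3
    by_contra hge
    push Not at hge
    have hgf : height g b.1 < height f b.1 := lt_of_lt_of_le hg3 hb5
    have hf1' : f.1.1 = e.1.1 := by rw [hf1]
    rcases lt_trichotomy g.1.1 e.1.1 with hlt | heq | hgt
    · have h1 := height_le_of_not_crosses (hX g hgE f hfE) hb1 hlt.le hf1'.le hg2.le hb3 hgf
      have h2 := height_le_of_not_crosses (hX e he g hgE) hb1 le_rfl hlt.le hb2.le hg2.le hge
      have h3 := height_left f
      rw [hf1'] at h3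
      rw [h3, hf1] at h1
      rw [height_left] at h2
      exact hG.avoid g hgE e.1 (hG.left_mem e he) hlt (by linarith) (le_antisymm h1 h2)
    · have h2 : g.1 = e.1 := hG.inj _ (hG.left_mem g hgE) _ (hG.left_mem e he) heq
      have hes : slope e < slope g := by
        simp only [height, h2] at hge
        nlinarith
      have := hfmin g ⟨hgE, h2, hes⟩
      simp only [height, h2, hf1] at hgf
      nlinarith
    · have h1 := height_le_of_not_crosses (hX g hgE f hfE) hg1 le_rfl (by linarith) hg2.le hb3 hgf
      have h2 := height_le_of_not_crosses (hX e he g hgE) hg1 hgt.le le_rfl hb2.le hg2.le hge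
      rw [height_left] at h1 h2
      have h3 := hG.avoid e he g.1 (hG.left_mem g hgE) hgt (by linarith)
      have := hbmin g.1 ⟨hG.left_mem g hgE, hgt, by linarith, by linarith, lt_of_le_of_ne h2 h3, h1⟩
      linarith

/-- Each edge is charged to its left endpoint, its right endpoint, or a vertex it is first below;
without crossings no vertex is charged twice in the same way. This replaces Euler's formula. -/
lemma card_edges_le_of_not_crosses (hG : IsGeomGraph N E)
    (hX : ∀ e ∈ E, ∀ f ∈ E, ¬ Crosses e f) : E.card ≤ 3 * N.card := by
  classical
  have hA : (E.filter (TopOut E)).card ≤ N.card := by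
    refine card_le_card_of_injOn (fun e => e.1) (fun e he => ?_) ?_
    · simp only [coe_filter, Set.mem_ofPred_eq] at he
      exact hG.left_mem e he.1
    · intro e he f hf hef
      simp only [coe_filter, Set.mem_ofPred_eq] at he hf hef
      by_contra hne
      have hs : slope e = slope f :=
        le_antisymm (hf.2 e he.1 hef) (he.2 f hf.1 hef.symm)
      have h1 := hG.lt e he.1
      have h2 := hG.lt f hf.1
      obtain ⟨x, hx1, hx2⟩ := exists_between (lt_min h1 (hef ▸ h2))
      rw [lt_min_iff] at hx2
      exact hX e he.1 f hf.1 ⟨hne, x, ⟨hx1, hx2.1⟩, ⟨by rwa [← hef], hx2.2⟩,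
        by simp [height, hs, hef]⟩
  have hB : (E.filter (TopIn E)).card ≤ N.card := by
    refine card_le_card_of_injOn (fun e => e.2) (fun e he => ?_) ?_
    · simp only [coe_filter, Set.mem_ofPred_eq] at he
      exact hG.right_mem e he.1
    · intro e he f hf hef
      simp only [coe_filter, Set.mem_ofPred_eq] at he hf hef
      by_contra hne
      have hs : slope e = slope f :=
        le_antisymm (he.2 f hf.1 hef.symm) (hf.2 e he.1 hef)
      have h1 := hG.lt e he.1
      have h2 := hG.lt f hf.1
      obtain ⟨x, hx1, hx2⟩ := exists_between (max_lt h1 (hef ▸ h2))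
      rw [max_lt_iff] at hx1
      refine hX e he.1 f hf.1 ⟨hne, x, ⟨hx1.1, hx2⟩, ⟨hx1.2, by rwa [← hef]⟩, ?_⟩
      rw [height_eq e x e.2.1, height_right h1, height_eq f x f.2.1, height_right h2, hs, hef]
  have hC : (E.filter (fun e => ∃ b ∈ N, FirstBelow E e b)).card ≤ N.card := by
    have : ∀ e ∈ E.filter (fun e => ∃ b ∈ N, FirstBelow E e b), ∃ b, b ∈ N ∧ FirstBelow E e b := by
      intro e he
      obtain ⟨b, h⟩ := (mem_filter.mp he).2
      exact ⟨b, h⟩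
    choose! φ hφ using this
    refine card_le_card_of_injOn φ (fun e he => (hφ e he).1) ?_
    intro e he f hf hef
    have h1 := (hφ e he).2
    have h2 := (hφ f hf).2
    rw [mem_coe, mem_filter] at he hf
    by_contra hne
    rw [← hef] at h2
    exact hX e he.1 f hf.1 ⟨hne, (φ e).1, ⟨h1.1, h1.2.1⟩, ⟨h2.1, h2.2.1⟩,
      le_antisymm (h2.2.2.2 e he.1 h1.1 h1.2.1 h1.2.2.1) (h1.2.2.2 f hf.1 h2.1 h2.2.1 h2.2.2.1)⟩
  have hcover : E ⊆ E.filter (TopOut E) ∪ E.filter (TopIn E) ∪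
      E.filter (fun e => ∃ b ∈ N, FirstBelow E e b) := by
    intro e he
    by_cases h1 : TopOut E e
    · simp [he, h1]
    by_cases h2 : TopIn E e
    · simp [he, h2]
    simp only [mem_union, mem_filter]
    exact Or.inr ⟨he, firstBelow_of_not_top hG hX he h1 h2⟩
  have := card_le_card hcover
  have := card_union_le (E.filter (TopOut E) ∪ E.filter (TopIn E))
    (E.filter (fun e => ∃ b ∈ N, FirstBelow E e b))
  have := card_union_le (E.filter (TopOut E)) (E.filter (TopIn E))
  omega

end Noncrossing

/-! ### The crossing lemma -/

open Classical in
noncomputable def crossings (E : Finset Edge) : Finset (Edge × Edge) :=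
  (E ×ˢ E).filter (fun x => Crosses x.1 x.2)

lemma mem_crossings {E : Finset Edge} {x : Edge × Edge} :
    x ∈ crossings E ↔ (x.1 ∈ E ∧ x.2 ∈ E) ∧ Crosses x.1 x.2 := by
  simp [crossings]

lemma IsGeomGraph.mono {N N' : Finset (ℝ × ℝ)} {E E' : Finset Edge} (hG : IsGeomGraph N E)
    (hN : N' ⊆ N) (hE : E' ⊆ E) (h1 : ∀ e ∈ E', e.1 ∈ N') (h2 : ∀ e ∈ E', e.2 ∈ N') :
    IsGeomGraph N' E' where
  inj p hp q hq := hG.inj p (hN hp) q (hN hq)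
  left_mem := h1
  right_mem := h2
  lt e he := hG.lt e (hE he)
  avoid e he b hb := hG.avoid e (hE he) b (hN hb)

/-- Deleting one edge of a crossing removes at least one crossing. -/
lemma card_edges_le_add_crossings {N : Finset (ℝ × ℝ)} {E : Finset Edge} (hG : IsGeomGraph N E) :
    E.card ≤ 3 * N.card + (crossings E).card := by
  classical
  induction E using Finset.strongInduction with
  | H E ih =>
    by_cases hX : ∀ e ∈ E, ∀ f ∈ E, ¬ Crosses e f
    · have := card_edges_le_of_not_crosses hG hX
      omega
    · push Not at hX
      obtain ⟨e, he, f, hf, hc⟩ := hX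
      have h1 := ih (E.erase e) (erase_ssubset he)
        (hG.mono subset_rfl (erase_subset _ _) (fun g hg => hG.left_mem g (mem_of_mem_erase hg))
          (fun g hg => hG.right_mem g (mem_of_mem_erase hg)))
      have h2 := card_erase_add_one he
      have h3 : (crossings (E.erase e)).card < (crossings E).card := by
        refine card_lt_card ⟨fun x hx => ?_, fun h => ?_⟩
        · rw [mem_crossings] at hx ⊢
          exact ⟨⟨mem_of_mem_erase hx.1.1, mem_of_mem_erase hx.1.2⟩, hx.2⟩
        · have : (e, f) ∈ crossings (E.erase e) := h (mem_crossings.mpr ⟨⟨he, hf⟩, hc⟩)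
          rw [mem_crossings] at this
          exact absurd this.1.1 (notMem_erase e E)
      omega

section Endpoints

variable {N : Finset (ℝ × ℝ)} {E : Finset Edge}

/-- Edges that share an endpoint and meet again are collinear, so one would contain an endpoint of
the other. Thus a crossing involves four vertices, the exponent needed for the sampling argument. -/
lemma left_ne_of_crosses (hG : IsGeomGraph N E) {e f : Edge} (he : e ∈ E) (hf : f ∈ E)
    (hc : Crosses e f) : e.1 ≠ f.1 := by
  intro h
  obtain ⟨hne, x, hx, hx', hh⟩ := hc
  have hs : slope e = slope f := by
    simp only [height, h] at hh
    have : f.1.1 < x := hx'.1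
    have h3 : (slope e - slope f) * (x - f.1.1) = 0 := by linarith
    rcases mul_eq_zero.mp h3 with h3 | h3 <;> linarith
  have hall : ∀ x, height e x = height f x := fun x => by simp [height, hs, h]
  have h11 : e.1.1 = f.1.1 := by rw [h]
  have hel := hG.lt e he
  have hfl := hG.lt f hf
  rcases lt_trichotomy e.2.1 f.2.1 with hlt | heq | hgt
  · exact hG.avoid f hf e.2 (hG.right_mem e he) (by linarith) hlt
      (by rw [← hall, height_right hel])
  · exact hne (Prod.ext h (hG.inj _ (hG.right_mem e he) _ (hG.right_mem f hf) heq))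
  · exact hG.avoid e he f.2 (hG.right_mem f hf) (by linarith) hgt
      (by rw [hall, height_right hfl])

lemma right_ne_of_crosses (hG : IsGeomGraph N E) {e f : Edge} (he : e ∈ E) (hf : f ∈ E)
    (hc : Crosses e f) : e.2 ≠ f.2 := by
  intro h
  obtain ⟨hne, x, hx, hx', hh⟩ := hc
  have hel := hG.lt e he
  have hfl := hG.lt f hf
  have hr : height e f.2.1 = height f f.2.1 := by
    rw [height_right hfl, ← h, height_right hel]
  have hs : slope e = slope f := by
    rw [height_eq e x f.2.1, height_eq f x f.2.1, hr] at hh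
    have h3 : (slope e - slope f) * (x - f.2.1) = 0 := by linarith
    rcases mul_eq_zero.mp h3 with h3 | h3 <;> linarith
  have hall : ∀ x, height e x = height f x := fun x => by
    rw [height_eq e x f.2.1, height_eq f x f.2.1, hr, hs]
  have h22 : e.2.1 = f.2.1 := by rw [h]
  rcases lt_trichotomy e.1.1 f.1.1 with hlt | heq | hgt
  · exact hG.avoid e he f.1 (hG.left_mem f hf) hlt (by linarith) (by rw [hall, height_left])
  · exact hne (Prod.ext (hG.inj _ (hG.left_mem e he) _ (hG.left_mem f hf) heq) h)
  · exact hG.avoid f hf e.1 (hG.left_mem e he) hgt (by linarith) (by rw [← hall, height_left])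

open Classical in
noncomputable def endpoints (e f : Edge) : Finset (ℝ × ℝ) := {e.1, e.2, f.1, f.2}

lemma card_endpoints (hG : IsGeomGraph N E) {e f : Edge} (he : e ∈ E) (hf : f ∈ E)
    (hc : Crosses e f) : (endpoints e f).card = 4 := by
  classical
  have hel := hG.lt e he
  have hfl := hG.lt f hf
  have h1 := left_ne_of_crosses hG he hf hc
  have h2 := right_ne_of_crosses hG he hf hc
  have h3 : e.1 ≠ e.2 := fun h => by rw [h] at hel; exact lt_irrefl _ hel
  have h4 : f.1 ≠ f.2 := fun h => by rw [h] at hfl; exact lt_irrefl _ hfl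
  obtain ⟨-, x, hx, hx', -⟩ := hc
  have h5 : e.1 ≠ f.2 := fun h => by rw [h] at hx; linarith
  have h6 : e.2 ≠ f.1 := fun h => by rw [h] at hx; linarith
  rw [endpoints, card_insert_of_notMem, card_insert_of_notMem, card_insert_of_notMem,
    card_singleton] <;> simp [*]

end Endpoints

/-- Number of functions that vanish on a given set. -/
lemma card_functions_vanishing {N T : Finset (ℝ × ℝ)} (hT : T ⊆ N) (m : ℕ) :
    (univ.filter (fun χ : N → Fin (m + 1) => ∀ x : N, (x : ℝ × ℝ) ∈ T → χ x = 0)).card *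
      (m + 1) ^ T.card = (m + 1) ^ N.card := by
  classical
  have h1 : univ.filter (fun χ : N → Fin (m + 1) => ∀ x : N, (x : ℝ × ℝ) ∈ T → χ x = 0) =
      Fintype.piFinset (fun x : N => if (x : ℝ × ℝ) ∈ T then {0} else univ) := by
    ext χ
    simp only [mem_filter, mem_univ, true_and, Fintype.mem_piFinset]
    refine forall_congr' fun x => ?_
    by_cases hx : (x : ℝ × ℝ) ∈ T <;> simp [hx]
  have h2 : (m + 1) ^ T.card = ∏ x ∈ N, if x ∈ T then (m + 1) else 1 := by
    rw [prod_ite_mem, inter_eq_right.mpr hT, prod_const]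
  rw [h1, Fintype.card_piFinset, h2,
    ← prod_coe_sort N (fun x => if x ∈ T then (m + 1) else 1), ← prod_mul_distrib]
  have : ∀ x : N, (if (x : ℝ × ℝ) ∈ T then ({0} : Finset (Fin (m + 1))) else univ).card *
      (if (x : ℝ × ℝ) ∈ T then (m + 1) else 1) = m + 1 := by
    intro x
    by_cases hx : (x : ℝ × ℝ) ∈ T <;> simp [hx]
  simp [this]

/-- The crossing lemma, in the form given by keeping each vertex with probability `1 / (m + 1)`. -/
lemma card_edges_mul_le {N : Finset (ℝ × ℝ)} {E : Finset Edge} (hG : IsGeomGraph N E) (m : ℕ) :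
    E.card * (m + 1) ^ 2 ≤ 3 * N.card * (m + 1) ^ 3 + (crossings E).card := by
  classical
  set van : (N → Fin (m + 1)) → Finset (ℝ × ℝ) → Prop :=
    fun χ T => ∀ x : N, (x : ℝ × ℝ) ∈ T → χ x = 0 with hvan
  -- Expectation as a double count: a vertex is kept when its colour is `0`, and a set of `j`
  -- vertices is kept by a fraction `(m + 1)^(-j)` of all colourings.
  have count : ∀ {β : Type} (F : Finset β) (ends : β → Finset (ℝ × ℝ)) (j : ℕ),
      (∀ b ∈ F, ends b ⊆ N ∧ (ends b).card = j) →
      (∑ χ : N → Fin (m + 1), (F.filter (fun b => van χ (ends b))).card) * (m + 1) ^ j =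
        F.card * (m + 1) ^ N.card := by
    intro β F ends j h
    simp_rw [card_filter]
    rw [sum_comm, sum_mul, card_eq_sum_ones, sum_mul]
    refine sum_congr rfl fun b hb => ?_
    rw [← card_filter, one_mul, ← (h b hb).2]
    exact card_functions_vanishing (h b hb).1 m
  have hS := count N (fun x => {x}) 1 (by simp)
  have hE := count E (fun e => {e.1, e.2}) 2 (by
    intro e he
    have hlt := hG.lt e he
    have hne : e.1 ≠ e.2 := fun h => by rw [h] at hlt; exact lt_irrefl _ hlt
    refine ⟨?_, card_pair hne⟩
    simp [insert_subset_iff, hG.left_mem e he, hG.right_mem e he])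
  have hX := count (crossings E) (fun x => endpoints x.1 x.2) 4 (by
    intro x hx
    rw [mem_crossings] at hx
    refine ⟨?_, card_endpoints hG hx.1.1 hx.1.2 hx.2⟩
    simp [endpoints, insert_subset_iff, hG.left_mem _ hx.1.1, hG.right_mem _ hx.1.1,
      hG.left_mem _ hx.1.2, hG.right_mem _ hx.1.2])
  have hle : ∑ χ : N → Fin (m + 1), (E.filter (fun e => van χ {e.1, e.2})).card ≤
      3 * (∑ χ : N → Fin (m + 1), (N.filter (fun x => van χ {x})).card) +
      ∑ χ : N → Fin (m + 1), ((crossings E).filter (fun x => van χ (endpoints x.1 x.2))).card := by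
    rw [mul_sum, ← sum_add_distrib]
    refine sum_le_sum fun χ _ => ?_
    have hG' : IsGeomGraph (N.filter (fun x => van χ {x}))
        (E.filter (fun e => van χ {e.1, e.2})) := by
      refine hG.mono (filter_subset _ _) (filter_subset _ _) ?_ ?_
      · intro e he
        rw [mem_filter] at he ⊢
        exact ⟨hG.left_mem e he.1, fun x hx => he.2 x (by simp_all)⟩
      · intro e he
        rw [mem_filter] at he ⊢
        exact ⟨hG.right_mem e he.1, fun x hx => he.2 x (by simp_all)⟩
    refine (card_edges_le_add_crossings hG').trans (Nat.add_le_add_left (card_le_card ?_) _)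
    intro x hx
    rw [mem_crossings, mem_filter, mem_filter] at hx
    rw [mem_filter, mem_crossings]
    refine ⟨⟨⟨hx.1.1.1, hx.1.2.1⟩, hx.2⟩, fun y hy => ?_⟩
    simp only [endpoints, mem_insert, mem_singleton] at hy
    rcases hy with hy | hy | hy | hy
    · exact hx.1.1.2 y (by simp [hy])
    · exact hx.1.1.2 y (by simp [hy])
    · exact hx.1.2.2 y (by simp [hy])
    · exact hx.1.2.2 y (by simp [hy])
  have hpos : 0 < (m + 1) ^ N.card := by positivity
  refine Nat.le_of_mul_le_mul_right ?_ hpos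
  have h4 := Nat.mul_le_mul_right ((m + 1) ^ 4) hle
  generalize (∑ χ : N → Fin (m + 1), (E.filter (fun e => van χ {e.1, e.2})).card) = a at *
  generalize (∑ χ : N → Fin (m + 1), (N.filter (fun x => van χ {x})).card) = b at *
  generalize (∑ χ : N → Fin (m + 1),
    ((crossings E).filter (fun x => van χ (endpoints x.1 x.2))).card) = c at *
  calc E.card * (m + 1) ^ 2 * (m + 1) ^ N.card
      = (E.card * (m + 1) ^ N.card) * (m + 1) ^ 2 := by ring
    _ = a * (m + 1) ^ 4 := by rw [← hE]; ring
    _ ≤ (3 * b + c) * (m + 1) ^ 4 := h4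
    _ = 3 * (m + 1) ^ 3 * (b * (m + 1) ^ 1) + c * (m + 1) ^ 4 := by ring
    _ = _ := by rw [hS, hX]; ring

/-! ### Rich points of a set of lines -/

/-- The point `x` is on the line with equation `c.1 * X + c.2.1 * Y = c.2.2`. -/
def OnLine (c : ℝ × ℝ × ℝ) (x : ℝ × ℝ) : Prop := c.1 * x.1 + c.2.1 * x.2 = c.2.2

lemma onLine_iff_height {c : ℝ × ℝ × ℝ} (hc : c.1 ≠ 0 ∨ c.2.1 ≠ 0) {e : Edge}
    (hlt : e.1.1 < e.2.1) (h1 : OnLine c e.1) (h2 : OnLine c e.2) (x y : ℝ) :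
    OnLine c (x, y) ↔ height e x = y := by
  have hd : e.2.1 - e.1.1 ≠ 0 := (sub_pos.mpr hlt).ne'
  simp only [OnLine] at *
  have hb : c.2.1 ≠ 0 := by
    intro hb
    rw [hb] at h1 h2
    have : c.1 * (e.2.1 - e.1.1) = 0 := by linarith
    rcases mul_eq_zero.mp this with h | h
    · rcases hc with hc | hc
      · exact hc h
      · exact hc hb
    · exact hd h
  have hs : c.2.1 * slope e = - c.1 := by
    simp only [slope]
    field_simp
    linarith
  have hh : c.2.1 * height e x = c.2.2 - c.1 * x := by
    simp only [height]
    linear_combination (x - e.1.1) * hs + h1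
  constructor
  · intro h
    apply mul_left_cancel₀ hb
    linarith
  · intro h
    rw [← h]
    linarith

/-- `e` joins two consecutive points of `T` on the line `c`. -/
def Consecutive (T : Finset (ℝ × ℝ)) (c : ℝ × ℝ × ℝ) (e : Edge) : Prop :=
  e.1 ∈ T ∧ e.2 ∈ T ∧ e.1.1 < e.2.1 ∧ OnLine c e.1 ∧ OnLine c e.2 ∧
    ∀ z ∈ T, OnLine c z → e.1.1 < z.1 → ¬ z.1 < e.2.1

section Distinct

variable {T : Finset (ℝ × ℝ)}

lemma Consecutive.eq (hT : ∀ p ∈ T, ∀ q ∈ T, p.1 = q.1 → p = q) {c : ℝ × ℝ × ℝ} {e f : Edge}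
    (he : Consecutive T c e) (hf : Consecutive T c f) {x : ℝ} (h1 : e.1.1 < x) (h2 : x < e.2.1)
    (h3 : f.1.1 < x) (h4 : x < f.2.1) : e = f := by
  obtain ⟨he1, he2, he3, he4, he5, he6⟩ := he
  obtain ⟨hf1, hf2, hf3, hf4, hf5, hf6⟩ := hf
  refine Prod.ext (hT _ he1 _ hf1 ?_) (hT _ he2 _ hf2 ?_)
  · rcases lt_trichotomy e.1.1 f.1.1 with h | h | h
    · exact absurd (h3.trans h2) (he6 _ hf1 hf4 h)
    · exact h
    · exact absurd (h1.trans h4) (hf6 _ he1 he4 h)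
  · rcases lt_trichotomy e.2.1 f.2.1 with h | h | h
    · exact absurd h (hf6 _ he2 he5 (h3.trans h2))
    · exact h
    · exact absurd h (he6 _ hf2 hf5 (h1.trans h4))

open Classical in
-- Every point on the line except the rightmost is joined to its successor.
lemma card_onLine_le (hT : ∀ p ∈ T, ∀ q ∈ T, p.1 = q.1 → p = q) (c : ℝ × ℝ × ℝ) :
    (T.filter (OnLine c)).card ≤ ((T ×ˢ T).filter (Consecutive T c)).card + 1 := by
  rcases (T.filter (OnLine c)).eq_empty_or_nonempty with h | h
  · simp [h]
  obtain ⟨M, hM, hmax⟩ := (T.filter (OnLine c)).exists_max_image (fun x => x.1) h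
  rw [← card_erase_add_one hM]
  refine Nat.add_le_add_right ?_ 1
  have : ∀ v ∈ (T.filter (OnLine c)).erase M, ∃ w, Consecutive T c (v, w) := by
    intro v hv
    have hv' := mem_filter.mp (mem_of_mem_erase hv)
    have hM' := mem_filter.mp hM
    have hlt : v.1 < M.1 := by
      refine lt_of_le_of_ne (hmax v (mem_of_mem_erase hv)) fun h => ?_
      exact ne_of_mem_erase hv (hT _ hv'.1 _ hM'.1 h)
    obtain ⟨w, hw, hmin⟩ := ((T.filter (OnLine c)).filter (fun w => v.1 < w.1)).exists_min_image
      (fun x => x.1) ⟨M, by simp [hM'.1, hM'.2, hlt]⟩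
    simp only [mem_filter] at hw hmin
    refine ⟨w, hv'.1, hw.1.1, hw.2, hv'.2, hw.1.2, fun z hz hz1 hz2 => ?_⟩
    exact not_lt.mpr (hmin z ⟨⟨hz, hz1⟩, hz2⟩)
  choose! φ hφ using this
  refine card_le_card_of_injOn (fun v => (v, φ v)) (fun v hv => ?_) ?_
  · rw [mem_coe, mem_filter, mem_product]
    exact ⟨⟨(hφ v hv).1, (hφ v hv).2.1⟩, hφ v hv⟩
  · intro v _ w _ h
    exact (Prod.mk.inj h).1

variable {ι : Type*} {L : Finset ι} {c : ι → ℝ × ℝ × ℝ}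

open Classical in
-- Székely's argument: join consecutive points on each line. Each line has at most one edge fewer
-- than its points, and an ordered pair of lines carries at most one crossing, because the lines
-- meet only once.
lemma card_mul_le_of_distinct (hT : ∀ p ∈ T, ∀ q ∈ T, p.1 = q.1 → p = q)
    (hc : ∀ i ∈ L, (c i).1 ≠ 0 ∨ (c i).2.1 ≠ 0)
    (hL : ∀ i ∈ L, ∀ j ∈ L, i ≠ j → ∀ x y, OnLine (c i) x → OnLine (c i) y →
      OnLine (c j) x → OnLine (c j) y → x = y)
    {r : ℕ} (hr : ∀ x ∈ T, r ≤ (L.filter (fun i => OnLine (c i) x)).card) (m : ℕ) :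
    (r * T.card) * (m + 1) ^ 2 ≤
      3 * T.card * (m + 1) ^ 3 + L.card ^ 2 + L.card * (m + 1) ^ 2 := by
  set E : Finset Edge := L.biUnion (fun i => (T ×ˢ T).filter (Consecutive T (c i))) with hE
  have hmem : ∀ e ∈ E, ∃ i ∈ L, Consecutive T (c i) e := by
    intro e he
    simp only [hE, mem_biUnion, mem_filter] at he
    obtain ⟨i, hi, -, h⟩ := he
    exact ⟨i, hi, h⟩
  have hG : IsGeomGraph T E :=
    { inj := hT
      left_mem := fun e he => by
        obtain ⟨i, -, h⟩ := hmem e he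
        exact h.1
      right_mem := fun e he => by
        obtain ⟨i, -, h⟩ := hmem e he
        exact h.2.1
      lt := fun e he => by
        obtain ⟨i, -, h⟩ := hmem e he
        exact h.2.2.1
      avoid := fun e he b hb h1 h2 h3 => by
        obtain ⟨i, hi, h⟩ := hmem e he
        have := (onLine_iff_height (hc i hi) h.2.2.1 h.2.2.2.1 h.2.2.2.2.1 b.1 b.2).mpr h3
        exact h.2.2.2.2.2 b hb this h1 h2 }
  have hcount : r * T.card ≤ E.card + L.card := by
    have h1 : E.card = ∑ i ∈ L, ((T ×ˢ T).filter (Consecutive T (c i))).card := by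
      refine card_biUnion fun i hi j hj hij => disjoint_left.mpr fun e h1 h2 => ?_
      have h1 := (mem_filter.mp h1).2
      have h2 := (mem_filter.mp h2).2
      have h3 := hL i hi j hj hij _ _ h1.2.2.2.1 h1.2.2.2.2.1 h2.2.2.2.1 h2.2.2.2.2.1
      have h4 := h1.2.2.1
      rw [h3] at h4
      exact lt_irrefl _ h4
    have h2 : r * T.card ≤ ∑ x ∈ T, (L.filter (fun i => OnLine (c i) x)).card := by
      rw [mul_comm, ← smul_eq_mul]
      exact card_nsmul_le_sum _ _ _ hr
    have h3 : ∑ x ∈ T, (L.filter (fun i => OnLine (c i) x)).card =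
        ∑ i ∈ L, (T.filter (OnLine (c i))).card := by
      simp_rw [card_filter]
      exact sum_comm
    have h4 : ∑ i ∈ L, (T.filter (OnLine (c i))).card ≤
        ∑ i ∈ L, (((T ×ˢ T).filter (Consecutive T (c i))).card + 1) :=
      sum_le_sum fun i _ => card_onLine_le hT (c i)
    rw [sum_add_distrib, ← h1, sum_const, smul_eq_mul, mul_one] at h4
    omega
  have hX : (crossings E).card ≤ L.card ^ 2 := by
    rcases isEmpty_or_nonempty ι with hι | hι
    · rw [eq_empty_of_forall_notMem (s := crossings E)
        fun x hx => hι.false (hmem _ (mem_crossings.mp hx).1.1).choose]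
      simp
    choose! φ hφL hφ using hmem
    rw [pow_two, ← card_product]
    have hpt : ∀ e ∈ E, ∀ x, OnLine (c (φ e)) (x, height e x) := fun e he x =>
      (onLine_iff_height (hc _ (hφL e he)) (hφ e he).2.2.1 (hφ e he).2.2.2.1
        (hφ e he).2.2.2.2.1 _ _).mpr rfl
    refine card_le_card_of_injOn (fun x => (φ x.1, φ x.2)) (fun x hx => ?_) ?_
    · rw [mem_coe, mem_crossings] at hx
      exact mem_coe.mpr (mem_product.mpr ⟨hφL _ hx.1.1, hφL _ hx.1.2⟩)
    · rintro ⟨e, f⟩ hef ⟨e', f'⟩ hef' h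
      rw [mem_coe, mem_crossings] at hef hef'
      obtain ⟨⟨he, hf⟩, hne, x, hxe, hxf, hx⟩ := hef
      obtain ⟨⟨he', hf'⟩, hne', x', hxe', hxf', hx'⟩ := hef'
      simp only [Prod.mk.injEq] at h he hf he' hf' hx hx' hxe hxf hxe' hxf' hne
      have hij : φ e ≠ φ f := by
        intro hij
        have h1 := hφ e he
        rw [hij] at h1
        exact hne (h1.eq hT (hφ f hf) hxe.1 hxe.2 hxf.1 hxf.2)
      have h1 := hpt e he x
      have h2 := hpt f hf x
      have h3 := hpt e' he' x'
      have h4 := hpt f' hf' x'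
      rw [← hx] at h2
      rw [← hx', ← h.2] at h4
      rw [← h.1] at h3
      have h5 := hL _ (hφL e he) _ (hφL f hf) hij _ _ h1 h3 h2 h4
      have h6 : x = x' := congrArg Prod.fst h5
      subst h6
      have h7 := hφ e' he'
      have h8 := hφ f' hf'
      rw [← h.1] at h7
      rw [← h.2] at h8
      exact Prod.ext ((hφ e he).eq hT h7 hxe.1 hxe.2 hxe'.1 hxe'.2)
        ((hφ f hf).eq hT h8 hxf.1 hxf.2 hxf'.1 hxf'.2)
  have := card_edges_mul_le hG m
  calc (r * T.card) * (m + 1) ^ 2 ≤ (E.card + L.card) * (m + 1) ^ 2 :=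
        Nat.mul_le_mul_right _ hcount
    _ = E.card * (m + 1) ^ 2 + L.card * (m + 1) ^ 2 := by ring
    _ ≤ _ := by linarith

end Distinct

variable {ι : Type*} {L : Finset ι} {c : ι → ℝ × ℝ × ℝ}

/-- The shear `(x, y) ↦ (x + τ y, y)`. -/
def shear (τ : ℝ) (x : ℝ × ℝ) : ℝ × ℝ := (x.1 + τ * x.2, x.2)

lemma shear_injective (τ : ℝ) : Function.Injective (shear τ) := by
  rintro ⟨a, b⟩ ⟨a', b'⟩ h
  simp only [shear, Prod.mk.injEq] at h
  obtain ⟨h1, h2⟩ := h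
  subst h2
  simpa using h1

lemma exists_shear (T : Finset (ℝ × ℝ)) :
    ∃ τ : ℝ, ∀ p ∈ T, ∀ q ∈ T, (shear τ p).1 = (shear τ q).1 → p = q := by
  classical
  obtain ⟨τ, hτ⟩ := Infinite.exists_notMem_finset
    ((T ×ˢ T).image (fun x => -(x.1.1 - x.2.1) / (x.1.2 - x.2.2)))
  refine ⟨τ, fun p hp q hq h => ?_⟩
  simp only [shear] at h
  by_cases h2 : p.2 = q.2
  · rw [h2] at h
    exact Prod.ext (by linarith) h2
  · exfalso
    apply hτ
    rw [mem_image]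
    refine ⟨(p, q), by simp [hp, hq], ?_⟩
    have : p.2 - q.2 ≠ 0 := sub_ne_zero.mpr h2
    field_simp
    linarith

lemma onLine_shear (c : ℝ × ℝ × ℝ) (τ : ℝ) (x : ℝ × ℝ) :
    OnLine (c.1, c.2.1 - τ * c.1, c.2.2) (shear τ x) ↔ OnLine c x := by
  simp only [OnLine, shear]
  constructor <;> intro h <;> linarith

/-- A form of the Szemerédi–Trotter bound for points lying on at least `r` lines. -/
lemma card_rich_points_le (T : Finset (ℝ × ℝ))
    (hc : ∀ i ∈ L, (c i).1 ≠ 0 ∨ (c i).2.1 ≠ 0)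
    (hL : ∀ i ∈ L, ∀ j ∈ L, i ≠ j → ∀ x y, OnLine (c i) x → OnLine (c i) y →
      OnLine (c j) x → OnLine (c j) y → x = y)
    {r : ℕ} (h12 : 12 ≤ r) (hr : ∀ x ∈ T, ∃ F ⊆ L, r ≤ F.card ∧ ∀ i ∈ F, OnLine (c i) x) :
    T.card * r ^ 3 ≤ 2304 * L.card ^ 2 + 2 * L.card * r ^ 2 := by
  classical
  obtain ⟨τ, hτ⟩ := exists_shear T
  -- With `12 (m + 1) ≤ r` the vertex term of the crossing lemma is at most a quarter of the left
  -- side; `r ≤ 24 (m + 1)` then costs the factor `24² = 576`.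
  obtain ⟨m, hm⟩ : ∃ m, r / 12 = m + 1 := Nat.exists_eq_succ_of_ne_zero (by omega)
  have key := card_mul_le_of_distinct (T := T.image (shear τ)) (L := L)
    (c := fun i => ((c i).1, (c i).2.1 - τ * (c i).1, (c i).2.2)) (r := r) ?_ ?_ ?_ ?_ m
  · rw [card_image_of_injective _ (shear_injective τ)] at key
    have h1 : 12 * (m + 1) ≤ r := by omega
    have h2 : r ≤ 24 * (m + 1) := by omega
    set t := T.card
    set k := L.card
    set q := m + 1
    by_cases h : 2 * k ≤ r * t
    · have h3 : k * q ^ 2 * 2 ≤ r * t * q ^ 2 := by nlinarith [Nat.mul_le_mul_right (q ^ 2) h]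
      have h4 : 12 * t * q ^ 3 ≤ r * t * q ^ 2 := by
        calc 12 * t * q ^ 3 = (12 * q) * (t * q ^ 2) := by ring
          _ ≤ r * (t * q ^ 2) := Nat.mul_le_mul_right _ h1
          _ = _ := by ring
      have h5 : r * t * q ^ 2 ≤ 4 * k ^ 2 := by linarith
      calc t * r ^ 3 = r * t * r ^ 2 := by ring
        _ ≤ r * t * (24 * q) ^ 2 := Nat.mul_le_mul_left _ (Nat.pow_le_pow_left h2 2)
        _ = 576 * (r * t * q ^ 2) := by ring
        _ ≤ 576 * (4 * k ^ 2) := Nat.mul_le_mul_left _ h5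
        _ ≤ _ := by nlinarith [Nat.zero_le (2 * k * r ^ 2)]
    · push Not at h
      calc t * r ^ 3 = r * t * r ^ 2 := by ring
        _ ≤ 2 * k * r ^ 2 := Nat.mul_le_mul_right _ h.le
        _ ≤ _ := Nat.le_add_left _ _
  · intro p hp q hq h
    rw [mem_image] at hp hq
    obtain ⟨p, hp, rfl⟩ := hp
    obtain ⟨q, hq, rfl⟩ := hq
    rw [hτ p hp q hq h]
  · intro i hi
    by_cases h : (c i).1 = 0
    · right
      have := (hc i hi).resolve_left (by simpa using h)
      simpa [h] using this
    · exact Or.inl h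
  · intro i hi j hj hij x y h1 h2 h3 h4
    have hx : x = shear τ (shear (-τ) x) := by simp [shear]
    have hy : y = shear τ (shear (-τ) y) := by simp [shear]
    rw [hx, onLine_shear] at h1 h3
    rw [hy, onLine_shear] at h2 h4
    rw [hx, hy, hL i hi j hj hij _ _ h1 h2 h3 h4]
  · intro x hx
    rw [mem_image] at hx
    obtain ⟨x, hx, rfl⟩ := hx
    simp only [onLine_shear]
    obtain ⟨F, hF, hle, hF2⟩ := hr x hx
    exact hle.trans (card_le_card fun i hi => mem_filter.mpr ⟨hF hi, hF2 i hi⟩)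

/-! ### Families of sets with small pairwise intersections -/

/-- With `S` the sum and `n = |U|`, Cauchy–Schwarz gives `S² ≤ n (S + |F|²)`. Since `|F| s ≤ S` and
`2n ≤ s²`, the term `n |F|²` is at most `S² / 2`. -/
lemma sum_card_le_of_pairwise_inter {α κ : Type*} [DecidableEq α] (U : Finset α) (F : Finset κ)
    (D : κ → Finset α) (hD : ∀ j ∈ F, D j ⊆ U)
    (hpair : ∀ i ∈ F, ∀ j ∈ F, i ≠ j → (D i ∩ D j).card ≤ 1) {s : ℕ}
    (hs : ∀ j ∈ F, s ≤ (D j).card) (hU : 2 * U.card ≤ s ^ 2) :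
    ∑ j ∈ F, (D j).card ≤ 2 * U.card := by
  classical
  set S := ∑ j ∈ F, (D j).card with hS
  set n := U.card
  have h1 : S = ∑ x ∈ U, (F.filter (fun j => x ∈ D j)).card := by
    simp_rw [card_filter]
    rw [sum_comm, hS]
    refine sum_congr rfl fun j hj => ?_
    rw [← card_filter, filter_mem_eq_inter, inter_eq_right.mpr (hD j hj)]
  have h2 : ∑ x ∈ U, (F.filter (fun j => x ∈ D j)).card ^ 2 ≤ S + F.card ^ 2 := by
    have h3 : ∑ x ∈ U, (F.filter (fun j => x ∈ D j)).card ^ 2 =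
        ∑ i ∈ F, ∑ j ∈ F, (D i ∩ D j).card := by
      have : ∀ x ∈ U, (F.filter (fun j => x ∈ D j)).card ^ 2 =
          ∑ i ∈ F, ∑ j ∈ F, if x ∈ D i ∩ D j then 1 else 0 := by
        intro x _
        rw [pow_two, card_filter, sum_mul_sum]
        refine sum_congr rfl fun i _ => sum_congr rfl fun j _ => ?_
        by_cases h1 : x ∈ D i <;> by_cases h2 : x ∈ D j <;> simp [h1, h2]
      rw [sum_congr rfl this, sum_comm]
      refine sum_congr rfl fun i hi => ?_
      rw [sum_comm]
      refine sum_congr rfl fun j _ => ?_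
      rw [← card_filter, filter_mem_eq_inter,
        inter_eq_right.mpr (inter_subset_left.trans (hD i hi))]
    rw [h3]
    calc ∑ i ∈ F, ∑ j ∈ F, (D i ∩ D j).card
        ≤ ∑ i ∈ F, ∑ j ∈ F, ((if i = j then (D i).card else 0) + 1) := by
          refine sum_le_sum fun i hi => sum_le_sum fun j hj => ?_
          by_cases hij : i = j
          · subst hij; simp
          · simpa [hij] using hpair i hi j hj hij
      _ = S + F.card ^ 2 := by
          simp only [sum_add_distrib, sum_const, smul_eq_mul, mul_one, pow_two]
          congr 1
          refine sum_congr rfl fun i hi => ?_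
          rw [sum_ite_eq, if_pos hi]
  have h4 : S ^ 2 ≤ n * (S + F.card ^ 2) := by
    calc S ^ 2 ≤ n * ∑ x ∈ U, (F.filter (fun j => x ∈ D j)).card ^ 2 := by
          rw [h1]; exact sq_sum_le_card_mul_sum_sq
      _ ≤ _ := Nat.mul_le_mul_left _ h2
  have h5 : F.card * s ≤ S := by
    rw [← smul_eq_mul]; exact card_nsmul_le_sum _ _ _ hs
  have h6 : 2 * n * F.card ^ 2 ≤ S ^ 2 := by
    calc 2 * n * F.card ^ 2 ≤ s ^ 2 * F.card ^ 2 := Nat.mul_le_mul_right _ hU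
      _ = (F.card * s) ^ 2 := by ring
      _ ≤ _ := Nat.pow_le_pow_left h5 2
  rcases Nat.eq_zero_or_pos S with h0 | h0
  · omega
  · refine Nat.le_of_mul_le_mul_right ?_ h0
    nlinarith

/-! ### A form of Beck's theorem for lines -/

lemma sq_le_add_sum_Ioc {K r s : ℕ} (h1 : K ≤ r) (h2 : r ≤ s) :
    r ^ 2 ≤ K ^ 2 + ∑ j ∈ Ioc K s, if j ≤ r then 2 * j else 0 := by
  rw [← sum_filter]
  have : (Ioc K s).filter (fun j => j ≤ r) = Ioc K r := by
    ext j; simp only [mem_filter, mem_Ioc]; omega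
  rw [this]
  clear this h2
  induction r, h1 using Nat.le_induction with
  | base => simp
  | succ r hr ih =>
    rw [← insert_Ioc_right_eq_Ioc_add_one hr, sum_insert (by simp)]
    nlinarith

def Parallel (c d : ℝ × ℝ × ℝ) : Prop := c.1 * d.2.1 = d.1 * c.2.1

/-- The common point of two lines that are not parallel. -/
noncomputable def meet (c d : ℝ × ℝ × ℝ) : ℝ × ℝ :=
  ((c.2.2 * d.2.1 - d.2.2 * c.2.1) / (c.1 * d.2.1 - d.1 * c.2.1),
    (c.1 * d.2.2 - d.1 * c.2.2) / (c.1 * d.2.1 - d.1 * c.2.1))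

lemma onLine_meet {c d : ℝ × ℝ × ℝ} (h : ¬ Parallel c d) :
    OnLine c (meet c d) ∧ OnLine d (meet c d) := by
  have : c.1 * d.2.1 - d.1 * c.2.1 ≠ 0 := sub_ne_zero.mpr h
  constructor <;>
  · simp only [OnLine, meet]
    rw [← mul_div_assoc, ← mul_div_assoc, ← add_div, div_eq_iff this]
    ring

section Beck

variable {ι : Type*} {L : Finset ι} {c : ι → ℝ × ℝ × ℝ}

open Classical in
/-- The intersection points of a set of lines. -/
noncomputable def vertices (L : Finset ι) (c : ι → ℝ × ℝ × ℝ) : Finset (ℝ × ℝ) :=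
  ((L ×ˢ L).filter (fun x => ¬ Parallel (c x.1) (c x.2))).image (fun x => meet (c x.1) (c x.2))

open Classical in
noncomputable def degree (L : Finset ι) (c : ι → ℝ × ℝ × ℝ) (x : ℝ × ℝ) : ℕ :=
  (L.filter (fun i => OnLine (c i) x)).card

open Classical in
-- An ordered pair of lines is either parallel or counted at its common point.
lemma sq_card_le_sum_sq_degree {s : ℕ}
    (hpar : ∀ i ∈ L, (L.filter (fun j => Parallel (c i) (c j))).card ≤ s) :
    L.card ^ 2 ≤ L.card * s + ∑ x ∈ vertices L c, degree L c x ^ 2 := by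
  have h1 := card_filter_add_card_filter_not (s := L ×ˢ L) (fun x => Parallel (c x.1) (c x.2))
  rw [card_product, ← pow_two] at h1
  rw [← h1]
  refine Nat.add_le_add ?_ ?_
  · rw [card_filter, sum_product, ← smul_eq_mul, ← sum_const]
    refine sum_le_sum fun i hi => ?_
    rw [← card_filter]
    exact hpar i hi
  · rw [card_eq_sum_card_image (fun x => meet (c x.1) (c x.2))]
    refine sum_le_sum fun x _ => ?_
    rw [degree, pow_two, ← card_product]
    refine card_le_card fun y hy => ?_
    simp only [mem_filter, mem_product] at hy ⊢
    obtain ⟨⟨⟨h1, h2⟩, h3⟩, rfl⟩ := hy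
    exact ⟨⟨h1, (onLine_meet h3).1⟩, h2, (onLine_meet h3).2⟩

/-- Summation by layers against the rich-point bound `t j ≤ 2304 k² / j³ + 2k / j`. The first term
leaves a tail of order `k² / K`; the second is controlled by the cut-off `s` on the degrees. -/
lemma sum_sq_degree_le
    (hc : ∀ i ∈ L, (c i).1 ≠ 0 ∨ (c i).2.1 ≠ 0)
    (hL : ∀ i ∈ L, ∀ j ∈ L, i ≠ j → ∀ x y, OnLine (c i) x → OnLine (c i) y →
      OnLine (c j) x → OnLine (c j) y → x = y) {s K : ℕ} (hK : 12 ≤ K)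
    (hdeg : ∀ x, degree L c x ≤ s) (T : Finset (ℝ × ℝ)) :
    (∑ x ∈ T.filter (fun x => K ≤ degree L c x), (degree L c x : ℝ) ^ 2) ≤
      6912 * (L.card : ℝ) ^ 2 / K + 2 * L.card * K + 4 * L.card * s := by
  classical
  set k : ℝ := (L.card : ℝ) with hk
  set t : ℕ → ℕ := fun j => (T.filter (fun x => j ≤ degree L c x)).card with ht
  have hrich : ∀ j, 12 ≤ j → (t j : ℝ) ≤ 2304 * k ^ 2 / (j : ℝ) ^ 3 + 2 * k / j := by
    intro j hj
    have h := card_rich_points_le (T.filter (fun x => j ≤ degree L c x)) hc hL hj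
      (fun x hx => ⟨_, filter_subset _ _, (mem_filter.mp hx).2, fun i hi => (mem_filter.mp hi).2⟩)
    have h' : (t j : ℝ) * (j : ℝ) ^ 3 ≤ 2304 * k ^ 2 + 2 * k * (j : ℝ) ^ 2 := by
      rw [hk]
      exact_mod_cast h
    have hj0 : (0 : ℝ) < j := by positivity
    have : 2304 * k ^ 2 / (j : ℝ) ^ 3 + 2 * k / j =
        (2304 * k ^ 2 + 2 * k * (j : ℝ) ^ 2) / (j : ℝ) ^ 3 := by
      field_simp
    rw [this, le_div_iff₀ (by positivity)]
    exact h'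
  have hk0 : 0 ≤ k := by positivity
  have hK0 : (0 : ℝ) < K := by positivity
  have h1 : (∑ x ∈ T.filter (fun x => K ≤ degree L c x), (degree L c x : ℝ) ^ 2) ≤
      (K : ℝ) ^ 2 * t K + ∑ j ∈ Ioc K s, 2 * (j : ℝ) * t j := by
    have h2 : ∑ x ∈ T.filter (fun x => K ≤ degree L c x), degree L c x ^ 2 ≤
        K ^ 2 * t K + ∑ j ∈ Ioc K s, 2 * j * t j := by
      calc ∑ x ∈ T.filter (fun x => K ≤ degree L c x), degree L c x ^ 2
          ≤ ∑ x ∈ T.filter (fun x => K ≤ degree L c x),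
            (K ^ 2 + ∑ j ∈ Ioc K s, if j ≤ degree L c x then 2 * j else 0) :=
            sum_le_sum fun x hx => sq_le_add_sum_Ioc (mem_filter.mp hx).2 (hdeg x)
        _ = K ^ 2 * t K + ∑ j ∈ Ioc K s, ∑ x ∈ T.filter (fun x => K ≤ degree L c x),
            if j ≤ degree L c x then 2 * j else 0 := by
            rw [sum_add_distrib, sum_const, smul_eq_mul, mul_comm, sum_comm]
        _ ≤ _ := by
            refine Nat.add_le_add_left (sum_le_sum fun j _ => ?_) _
            rw [← sum_filter, sum_const, smul_eq_mul, mul_comm]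
            refine Nat.mul_le_mul_left _ (card_le_card ?_)
            rw [filter_filter]
            exact monotone_filter_right _ fun x _ hx => hx.2
    exact_mod_cast h2
  have h3 : (K : ℝ) ^ 2 * t K ≤ 2304 * k ^ 2 / K + 2 * k * K := by
    calc (K : ℝ) ^ 2 * t K ≤ (K : ℝ) ^ 2 * (2304 * k ^ 2 / (K : ℝ) ^ 3 + 2 * k / K) :=
          mul_le_mul_of_nonneg_left (hrich K hK) (by positivity)
      _ = _ := by field_simp
  have h4 : ∑ j ∈ Ioc K s, 2 * (j : ℝ) * t j ≤ 4608 * k ^ 2 / K + 4 * k * s := by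
    calc ∑ j ∈ Ioc K s, 2 * (j : ℝ) * t j
        ≤ ∑ j ∈ Ioc K s, (4608 * k ^ 2 * ((j : ℝ) ^ 2)⁻¹ + 4 * k) := by
          refine sum_le_sum fun j hj => ?_
          have hj' : 12 ≤ j := by have := (mem_Ioc.mp hj).1; omega
          have hj0 : (0 : ℝ) < j := by positivity
          calc 2 * (j : ℝ) * t j ≤ 2 * (j : ℝ) * (2304 * k ^ 2 / (j : ℝ) ^ 3 + 2 * k / j) :=
                mul_le_mul_of_nonneg_left (hrich j hj') (by positivity)
            _ = _ := by field_simp; ring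
      _ = 4608 * k ^ 2 * ∑ j ∈ Ioc K s, ((j : ℝ) ^ 2)⁻¹ + (Ioc K s).card * (4 * k) := by
          rw [sum_add_distrib, ← mul_sum, sum_const, nsmul_eq_mul]
      _ ≤ 4608 * k ^ 2 * (K : ℝ)⁻¹ + s * (4 * k) := by
          refine add_le_add (mul_le_mul_of_nonneg_left ?_ (by positivity))
            (mul_le_mul_of_nonneg_right ?_ (by positivity))
          · rcases le_total K s with hKs | hKs
            · have := sum_Ioc_inv_sq_le_sub (α := ℝ) (k := K) (n := s) (by omega) hKs
              have h5 : (0 : ℝ) ≤ (s : ℝ)⁻¹ := by positivity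
              linarith
            · rw [Ioc_eq_empty (by omega), sum_empty]
              positivity
          · rw [Nat.card_Ioc]
            exact_mod_cast Nat.sub_le s K
      _ = _ := by ring
  have h5 : 6912 * k ^ 2 / K = 2304 * k ^ 2 / K + 4608 * k ^ 2 / K := by ring
  linarith

open Classical in
/-- Lines of which few are concurrent and few are parallel have many intersection points. -/
lemma sq_card_le_mul_sum_degree
    (hc : ∀ i ∈ L, (c i).1 ≠ 0 ∨ (c i).2.1 ≠ 0)
    (hL : ∀ i ∈ L, ∀ j ∈ L, i ≠ j → ∀ x y, OnLine (c i) x → OnLine (c i) y →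
      OnLine (c j) x → OnLine (c j) y → x = y) {s : ℕ} (hs : 1 ≤ s)
    (hdeg : ∀ x, degree L c x ≤ s)
    (hpar : ∀ i ∈ L, (L.filter (fun j => Parallel (c i) (c j))).card ≤ s)
    (hbig : 300000 * s ≤ L.card) :
    L.card ^ 2 ≤ 120000 * ∑ i ∈ L, ((vertices L c).filter (fun x => OnLine (c i) x)).card := by
  have h0 : ∑ i ∈ L, ((vertices L c).filter (fun x => OnLine (c i) x)).card =
      ∑ x ∈ vertices L c, degree L c x := by
    simp_rw [degree, card_filter]
    exact sum_comm
  rw [h0]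
  have h1 := sq_card_le_sum_sq_degree hpar
  -- `27648 = 4 · 6912`, so points of degree at least `K` account for only `k² / 4` plus terms that
  -- `hbig` makes small. At the other points the square of the degree is at most `K` times the
  -- degree.
  have h2 := sum_sq_degree_le hc hL (K := 27648) (by norm_num) hdeg (vertices L c)
  have h3 : (∑ x ∈ (vertices L c).filter (fun x => ¬ 27648 ≤ degree L c x),
      (degree L c x : ℝ) ^ 2) ≤ 27648 * ∑ x ∈ vertices L c, (degree L c x : ℝ) := by
    calc (∑ x ∈ (vertices L c).filter (fun x => ¬ 27648 ≤ degree L c x), (degree L c x : ℝ) ^ 2)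
        ≤ ∑ x ∈ (vertices L c).filter (fun x => ¬ 27648 ≤ degree L c x),
          27648 * (degree L c x : ℝ) := by
          refine sum_le_sum fun x hx => ?_
          have h := (mem_filter.mp hx).2
          push Not at h
          have h' : (degree L c x : ℝ) ≤ 27648 := by exact_mod_cast h.le
          rw [pow_two]
          exact mul_le_mul_of_nonneg_right h' (by positivity)
      _ ≤ ∑ x ∈ vertices L c, 27648 * (degree L c x : ℝ) :=
          sum_le_sum_of_subset_of_nonneg (filter_subset _ _) fun x _ _ => by positivity
      _ = _ := by rw [mul_sum]
  have h4 := sum_filter_add_sum_filter_not (vertices L c) (fun x => 27648 ≤ degree L c x)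
    (fun x => (degree L c x : ℝ) ^ 2)
  have h5 : (L.card : ℝ) ^ 2 ≤ L.card * s + ∑ x ∈ vertices L c, (degree L c x : ℝ) ^ 2 := by
    exact_mod_cast h1
  have h6 : (300000 : ℝ) * s ≤ L.card := by exact_mod_cast hbig
  have h7 : (1 : ℝ) ≤ s := by exact_mod_cast hs
  have h8 : (L.card : ℝ) ^ 2 ≤ 120000 * ∑ x ∈ vertices L c, (degree L c x : ℝ) := by
    generalize (∑ x ∈ vertices L c, (degree L c x : ℝ)) = R at *
    generalize (∑ x ∈ vertices L c, (degree L c x : ℝ) ^ 2) = Q at *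
    generalize (L.card : ℝ) = k at *
    generalize (s : ℝ) = σ at *
    have hk : 300000 * (k * σ) ≤ k ^ 2 := by nlinarith
    have hk' : 300000 * k ≤ k ^ 2 := by nlinarith
    push_cast at h2
    linarith
  exact_mod_cast h8

end Beck

/-! ### Reflections and rotation centres -/

lemma algDist_eq (a b : Plane) : algDist a b = (a 0 - b 0) ^ 2 + (a 1 - b 1) ^ 2 := by
  simp only [algDist, PiLp.inner_apply, Fin.sum_univ_two]
  simp [pow_two]

lemma eq_zero_of_sq_add_sq {x y : ℝ} (h : x ^ 2 + y ^ 2 = 0) : x = 0 ∧ y = 0 := by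
  constructor <;> nlinarith [sq_nonneg x, sq_nonneg y]

lemma plane_ext {a b : Plane} (h0 : a 0 = b 0) (h1 : a 1 = b 1) : a = b := by
  ext i
  fin_cases i
  · exact h0
  · exact h1

lemma algDist_pos {a b : Plane} (h : a ≠ b) : 0 < (b 0 - a 0) ^ 2 + (b 1 - a 1) ^ 2 := by
  by_contra hn
  have h0 : (b 0 - a 0) ^ 2 = 0 := by nlinarith [sq_nonneg (b 0 - a 0), sq_nonneg (b 1 - a 1)]
  have h1 : (b 1 - a 1) ^ 2 = 0 := by nlinarith [sq_nonneg (b 0 - a 0), sq_nonneg (b 1 - a 1)]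
  rw [sq_eq_zero_iff, sub_eq_zero] at h0 h1
  exact h (plane_ext h0.symm h1.symm)

/-- `d` is the reflection of `c` in the perpendicular bisector of `a` and `b`. -/
def IsReflection (a b c d : Plane) : Prop :=
  ∃ l : ℝ, d 0 = c 0 - l * (b 0 - a 0) ∧ d 1 = c 1 - l * (b 1 - a 1) ∧
    l * ((b 0 - a 0) ^ 2 + (b 1 - a 1) ^ 2) =
      (2 * c 0 - a 0 - b 0) * (b 0 - a 0) + (2 * c 1 - a 1 - b 1) * (b 1 - a 1)

lemma IsReflection.unique {a b c d d' : Plane} (hab : a ≠ b) (h : IsReflection a b c d)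
    (h' : IsReflection a b c d') : d = d' := by
  obtain ⟨l, h0, h1, hl⟩ := h
  obtain ⟨l', h0', h1', hl'⟩ := h'
  have : l = l' := mul_right_cancel₀ (algDist_pos hab).ne' (hl.trans hl'.symm)
  subst this
  exact plane_ext (by rw [h0, h0']) (by rw [h1, h1'])

lemma IsReflection.symm {a b c d : Plane} (h : IsReflection a b c d) : IsReflection b a d c := by
  obtain ⟨l, h0, h1, hl⟩ := h
  refine ⟨l, by linarith, by linarith, ?_⟩
  rw [h0, h1]
  linear_combination (-1 : ℝ) * hl

lemma isReflection_of_mem_variety {a b c d : Plane} (hab : a ≠ b) (h : (b, d) ∈ variety a c) :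
    IsReflection a b c d := by
  have hN := algDist_pos hab
  rcases h with (⟨-, hcd, hB⟩ | ⟨h, -⟩) | ⟨h, -, hc⟩
  · simp only at hcd hB
    -- The midpoint and a second point of the bisector: that both are equidistant from `c` and `d`
    -- makes `cd` parallel to `ab` and fixes the reflection.
    set x : Plane := !₂[(a 0 + b 0) / 2, (a 1 + b 1) / 2] with hx
    set y : Plane := !₂[(a 0 + b 0) / 2 - (b 1 - a 1), (a 1 + b 1) / 2 + (b 0 - a 0)] with hy
    have hxa : x ∈ bisector a b := by
      simp only [bisector, Set.mem_ofPred_eq, algDist_eq, hx]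
      simp
      ring
    have hya : y ∈ bisector a b := by
      simp only [bisector, Set.mem_ofPred_eq, algDist_eq, hy]
      simp
      ring
    rw [hB] at hxa hya
    simp only [bisector, Set.mem_ofPred_eq, algDist_eq, hx, hy] at hxa hya
    simp at hxa hya
    have hperp : (d 1 - c 1) * (b 0 - a 0) = (d 0 - c 0) * (b 1 - a 1) := by
      linear_combination (hya - hxa) / 2
    set N := (b 0 - a 0) ^ 2 + (b 1 - a 1) ^ 2 with hNdef
    obtain ⟨l, hlN⟩ : ∃ l : ℝ, l * N = -((d 0 - c 0) * (b 0 - a 0) + (d 1 - c 1) * (b 1 - a 1)) :=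
      ⟨_ / N, div_mul_cancel₀ _ hN.ne'⟩
    have h0 : d 0 = c 0 - l * (b 0 - a 0) := by
      apply mul_right_cancel₀ hN.ne'
      linear_combination (b 1 - a 1) * (-hperp) + (b 0 - a 0) * hlN + (d 0 - c 0) * hNdef
    have h1 : d 1 = c 1 - l * (b 1 - a 1) := by
      apply mul_right_cancel₀ hN.ne'
      linear_combination (b 0 - a 0) * hperp + (b 1 - a 1) * hlN + (d 1 - c 1) * hNdef
    refine ⟨l, h0, h1, ?_⟩
    have hl0 : l ≠ 0 := by
      intro h
      rw [h] at h0 h1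
      exact hcd (plane_ext (by linarith) (by linarith))
    apply mul_left_cancel₀ hl0
    rw [h0, h1] at hxa
    linear_combination -hxa
  · exact absurd h.symm hab
  · simp only at h hc
    subst h
    simp only [bisector, Set.mem_ofPred_eq, algDist_eq] at hc
    exact ⟨0, by ring, by ring, by linear_combination -hc⟩

/-- The power of `x` with respect to the point `o` given in homogeneous coordinates, up to a term
not depending on `x`. -/
def power (o : ℝ × ℝ × ℝ) (x : Plane) : ℝ :=
  (x 0 ^ 2 + x 1 ^ 2) * o.2.2 - 2 * (x 0 * o.1 + x 1 * o.2.1)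

/-- Twice the signed area of the triangle `o, x, y`, where `o` is given in homogeneous
coordinates. -/
def area (o : ℝ × ℝ × ℝ) (x y : Plane) : ℝ :=
  (x 0 * y 1 - x 1 * y 0) * o.2.2 - (x 0 * o.2.1 - x 1 * o.1) - (o.1 * y 1 - o.2.1 * y 0)

/-- Two pairs at the same distance have the same `key o` if they differ by a rotation about `o`
(or a translation, for `o` at infinity). -/
def key (o : ℝ × ℝ × ℝ) (p : Plane × Plane) : ℝ × ℝ × ℝ := (power o p.1, power o p.2, area o p.1 p.2)

/-- By `ho` the centre `o` is on the axis, so the reflection fixes it, preserves powers and reverses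
areas. The right side depends only on `o`, `a`, `c`. -/
lemma IsReflection.key_eq {a b c d : Plane} (hab : a ≠ b) (h : IsReflection a b c d)
    {o : ℝ × ℝ × ℝ} (ho : power o a = power o b) :
    key o (b, d) = (power o a, power o c, - area o a c) := by
  obtain ⟨l, h0, h1, hl⟩ := h
  have hN := algDist_pos hab
  simp only [power] at ho
  simp only [key, Prod.mk.injEq]
  refine ⟨?_, ?_, ?_⟩
  · simp only [power]
    linarith
  · simp only [power]
    rw [h0, h1]
    linear_combination l * ho + l * o.2.2 * hl
  · set N := (b 0 - a 0) ^ 2 + (b 1 - a 1) ^ 2 with hNdef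
    obtain ⟨μ, hμ0, hμ1⟩ : ∃ μ : ℝ, o.1 = o.2.2 * (a 0 + b 0) / 2 - μ * (b 1 - a 1) ∧
        o.2.1 = o.2.2 * (a 1 + b 1) / 2 + μ * (b 0 - a 0) := by
      obtain ⟨μ, hμ⟩ : ∃ μ : ℝ, μ * N = (b 0 - a 0) * (o.2.1 - o.2.2 * (a 1 + b 1) / 2) -
          (b 1 - a 1) * (o.1 - o.2.2 * (a 0 + b 0) / 2) := ⟨_ / N, div_mul_cancel₀ _ hN.ne'⟩
      refine ⟨μ, mul_right_cancel₀ hN.ne' ?_, mul_right_cancel₀ hN.ne' ?_⟩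
      · linear_combination (o.1 - o.2.2 * (a 0 + b 0) / 2) * hNdef + (b 1 - a 1) * hμ +
          (b 0 - a 0) / 2 * ho
      · linear_combination (o.2.1 - o.2.2 * (a 1 + b 1) / 2) * hNdef - (b 0 - a 0) * hμ +
          (b 1 - a 1) / 2 * ho
    simp only [area]
    rw [h0, h1, hμ0, hμ1]
    rw [hNdef] at hl
    linear_combination -μ * hl

/-- The key is linear in `o`, so its change from `p` to `p'` is given by three coefficient rows,
each orthogonal to `o` and `o'` and hence a multiple of their cross product `q` if `q ≠ 0`. If `q1 =
q2 = 0`, nothing moves. Otherwise `e - f` is both parallel and perpendicular to `(q1, q2)`, so both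
points move by the same vector `e`; then `E = F` and `G = 0` make `e` perpendicular and parallel to
`b - d`, which is nonzero as `r ≠ 0`. -/
lemma eq_of_key_eq {p p' : Plane × Plane} {r : ℝ} (hr : r ≠ 0) (hp : algDist p.1 p.2 = r)
    {o o' : ℝ × ℝ × ℝ} (h : key o p = key o p') (h' : key o' p = key o' p')
    (hne : p ≠ p') :
    o.2.1 * o'.2.2 - o.2.2 * o'.2.1 = 0 ∧ o.2.2 * o'.1 - o.1 * o'.2.2 = 0 ∧
      o.1 * o'.2.1 - o.2.1 * o'.1 = 0 := by
  obtain ⟨b, d⟩ := p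
  obtain ⟨b', d'⟩ := p'
  obtain ⟨o1, o2, o3⟩ := o
  obtain ⟨u1, u2, u3⟩ := o'
  simp only [key, power, area, Prod.mk.injEq, algDist_eq] at *
  obtain ⟨h1, h2, h3⟩ := h
  obtain ⟨k1, k2, k3⟩ := h'
  have hbd : b ≠ b' ∨ d ≠ d' := by
    by_contra hcon
    push Not at hcon
    exact hne (Prod.ext hcon.1 hcon.2)
  set q1 := o2 * u3 - o3 * u2 with hq1
  set q2 := o3 * u1 - o1 * u3 with hq2
  set q3 := o1 * u2 - o2 * u1 with hq3
  set e0 := b 0 - b' 0 with he0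
  set e1 := b 1 - b' 1 with he1
  set f0 := d 0 - d' 0 with hf0
  set f1 := d 1 - d' 1 with hf1
  set E := b 0 ^ 2 + b 1 ^ 2 - (b' 0 ^ 2 + b' 1 ^ 2) with hE
  set F := d 0 ^ 2 + d 1 ^ 2 - (d' 0 ^ 2 + d' 1 ^ 2) with hF
  set G := b 0 * d 1 - b 1 * d 0 - (b' 0 * d' 1 - b' 1 * d' 0) with hG
  have row : ∀ {x y z : ℝ}, x * o1 + y * o2 + z * o3 = 0 → x * u1 + y * u2 + z * u3 = 0 →
      x * q2 = y * q1 ∧ z * q1 = x * q3 ∧ z * q2 = y * q3 := by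
    intro x y z hx hy
    refine ⟨?_, ?_, ?_⟩
    · rw [hq1, hq2]; linear_combination u3 * (-hx) + o3 * hy
    · rw [hq1, hq3]; linear_combination o2 * hy - u2 * hx
    · rw [hq2, hq3]; linear_combination u1 * hx - o1 * hy
  obtain ⟨r1, r2, r2'⟩ := row (x := -2 * e0) (y := -2 * e1) (z := E)
    (by linear_combination h1) (by linear_combination k1)
  obtain ⟨s1, s2, s2'⟩ := row (x := -2 * f0) (y := -2 * f1) (z := F)
    (by linear_combination h2) (by linear_combination k2)
  obtain ⟨t1, t2, t2'⟩ := row (x := e1 - f1) (y := f0 - e0) (z := G)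
    (by linear_combination h3) (by linear_combination k3)
  have hzero : e0 = 0 → e1 = 0 → f0 = 0 → f1 = 0 → False := by
    intro h0 h1 h2 h3
    rcases hbd with hb | hd
    · exact hb (plane_ext (sub_eq_zero.mp (he0 ▸ h0)) (sub_eq_zero.mp (he1 ▸ h1)))
    · exact hd (plane_ext (sub_eq_zero.mp (hf0 ▸ h2)) (sub_eq_zero.mp (hf1 ▸ h3)))
  clear_value q1 q2 q3 e0 e1 f0 f1 E F G
  by_cases hQ : q1 ^ 2 + q2 ^ 2 = 0
  · obtain ⟨hq1', hq2'⟩ := eq_zero_of_sq_add_sq hQ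
    refine ⟨hq1', hq2', ?_⟩
    by_contra hq3'
    rw [hq1', mul_zero] at r2 s2
    rw [hq2', mul_zero] at r2' s2'
    refine hzero (mul_right_cancel₀ hq3' ?_) (mul_right_cancel₀ hq3' ?_)
      (mul_right_cancel₀ hq3' ?_) (mul_right_cancel₀ hq3' ?_)
    · linear_combination r2 / 2
    · linear_combination r2' / 2
    · linear_combination s2 / 2
    · linear_combination s2' / 2
  · exfalso
    have g0 : e0 = f0 := by
      have : (q1 ^ 2 + q2 ^ 2) * (e0 - f0) = 0 := by
        linear_combination q2 * (-r1 / 2 + s1 / 2) + q1 * t1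
      exact sub_eq_zero.mp ((mul_eq_zero.mp this).resolve_left hQ)
    have g1 : e1 = f1 := by
      have : (q1 ^ 2 + q2 ^ 2) * (e1 - f1) = 0 := by
        linear_combination q1 * (r1 / 2 - s1 / 2) + q2 * t1
      exact sub_eq_zero.mp ((mul_eq_zero.mp this).resolve_left hQ)
    have gG : G = 0 := by
      have : (q1 ^ 2 + q2 ^ 2) * G = 0 := by
        rw [g1] at t2
        rw [g0] at t2'
        linear_combination q1 * t2 + q2 * t2'
      exact (mul_eq_zero.mp this).resolve_left hQ
    have gE : E = F := by
      have : (q1 ^ 2 + q2 ^ 2) * (E - F) = 0 := by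
        rw [g0] at r2
        rw [g1] at r2'
        linear_combination q1 * (r2 - s2) + q2 * (r2' - s2')
      exact sub_eq_zero.mp ((mul_eq_zero.mp this).resolve_left hQ)
    have hb0 : b' 0 = b 0 - e0 := by rw [he0]; ring
    have hb1 : b' 1 = b 1 - e1 := by rw [he1]; ring
    have hd0 : d' 0 = d 0 - e0 := by rw [g0, hf0]; ring
    have hd1 : d' 1 = d 1 - e1 := by rw [g1, hf1]; ring
    have hdot : (b 0 - d 0) * e0 + (b 1 - d 1) * e1 = 0 := by
      rw [hE, hF, hb0, hb1, hd0, hd1] at gE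
      linear_combination gE / 2
    have hdet : (b 0 - d 0) * e1 - (b 1 - d 1) * e0 = 0 := by
      rw [hG, hb0, hb1, hd0, hd1] at gG
      linear_combination gG
    have he : r * (e0 ^ 2 + e1 ^ 2) = 0 := by
      rw [← hp]
      linear_combination ((b 0 - d 0) * e0 + (b 1 - d 1) * e1) * hdot +
        ((b 0 - d 0) * e1 - (b 1 - d 1) * e0) * hdet
    have he' := (mul_eq_zero.mp he).resolve_left hr
    obtain ⟨z0, z1⟩ := eq_zero_of_sq_add_sq he'
    exact hzero z0 z1 (g0 ▸ z0) (g1 ▸ z1)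

lemma exists_smul_of_cross_eq_zero {o o' : ℝ × ℝ × ℝ} (ho : o ≠ 0)
    (h : o.2.1 * o'.2.2 - o.2.2 * o'.2.1 = 0 ∧ o.2.2 * o'.1 - o.1 * o'.2.2 = 0 ∧
      o.1 * o'.2.1 - o.2.1 * o'.1 = 0) : ∃ t : ℝ, o' = t • o := by
  obtain ⟨o1, o2, o3⟩ := o
  obtain ⟨u1, u2, u3⟩ := o'
  obtain ⟨h1, h2, h3⟩ := h
  simp only at h1 h2 h3
  by_cases ho1 : o1 = 0
  · by_cases ho2 : o2 = 0
    · have ho3 : o3 ≠ 0 := by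
        rintro rfl
        exact ho (by simp [ho1, ho2])
      refine ⟨u3 / o3, ?_⟩
      simp only [Prod.smul_mk, smul_eq_mul, Prod.mk.injEq]
      refine ⟨?_, ?_, ?_⟩ <;> field_simp <;> linarith
    · refine ⟨u2 / o2, ?_⟩
      simp only [Prod.smul_mk, smul_eq_mul, Prod.mk.injEq]
      refine ⟨?_, ?_, ?_⟩ <;> field_simp <;> linarith
  · refine ⟨u1 / o1, ?_⟩
    simp only [Prod.smul_mk, smul_eq_mul, Prod.mk.injEq]
    refine ⟨?_, ?_, ?_⟩ <;> field_simp <;> linarith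

lemma power_smul (t : ℝ) (o : ℝ × ℝ × ℝ) (x : Plane) : power (t • o) x = t * power o x := by
  simp only [power, Prod.smul_fst, Prod.smul_snd, smul_eq_mul]; ring

lemma area_smul (t : ℝ) (o : ℝ × ℝ × ℝ) (x y : Plane) : area (t • o) x y = t * area o x y := by
  simp only [area, Prod.smul_fst, Prod.smul_snd, smul_eq_mul]; ring

lemma key_smul (t : ℝ) (o : ℝ × ℝ × ℝ) (p : Plane × Plane) : key (t • o) p = t • key o p := by
  simp [key, power_smul, area_smul]

lemma isLine_or_isCircle {o : ℝ × ℝ × ℝ} (ho : o ≠ 0) {a b : Plane} (hab : a ≠ b)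
    (h : power o a = power o b) :
    IsLine {x | power o x = power o b} ∨ IsCircle {x | power o x = power o b} := by
  by_cases h3 : o.2.2 = 0
  · left
    have hN : 0 < o.1 ^ 2 + o.2.1 ^ 2 := by
      by_contra hn
      have h0 : o.1 = 0 := by nlinarith [sq_nonneg o.1, sq_nonneg o.2.1]
      have h1 : o.2.1 = 0 := by nlinarith [sq_nonneg o.1, sq_nonneg o.2.1]
      exact ho (Prod.ext h0 (Prod.ext h1 h3))
    set w : Plane := !₂[-o.2.1, o.1] with hw
    have hw0 : w ≠ 0 := by
      intro hw0
      have e0 := congrArg (fun z : Plane => z 0) hw0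
      have e1 := congrArg (fun z : Plane => z 1) hw0
      simp [hw] at e0 e1
      rw [e0, e1] at hN
      norm_num at hN
    refine ⟨AffineSubspace.mk' b (Submodule.span ℝ {w}), ?_, ?_⟩
    · rw [AffineSubspace.direction_mk', finrank_span_singleton hw0]
    · ext x
      rw [SetLike.mem_coe, AffineSubspace.mem_mk', Submodule.mem_span_singleton, vsub_eq_sub]
      simp only [Set.mem_ofPred_eq, power, h3]
      constructor
      · intro hx
        refine ⟨((x 1 - b 1) * o.1 - (x 0 - b 0) * o.2.1) / (o.1 ^ 2 + o.2.1 ^ 2),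
          plane_ext ?_ ?_⟩
        · simp [hw]
          field_simp
          linear_combination o.1 * hx / 2
        · simp [hw]
          field_simp
          linear_combination o.2.1 * hx / 2
      · rintro ⟨t, ht⟩
        have e0 := congrArg (fun z : Plane => z 0) ht
        have e1 := congrArg (fun z : Plane => z 1) ht
        simp [hw] at e0 e1
        linear_combination 2 * o.1 * e0 + 2 * o.2.1 * e1
  · right
    set z : Plane := !₂[o.1 / o.2.2, o.2.1 / o.2.2] with hz
    have hdist : ∀ x y : Plane, dist x z = dist y z ↔ power o x = power o y := by
      intro x y
      have hd : ∀ x : Plane, dist x z ^ 2 = (x 0 - z 0) ^ 2 + (x 1 - z 1) ^ 2 := by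
        intro x
        rw [← algDist_eq, algDist, real_inner_self_eq_norm_sq, dist_eq_norm]
      rw [← sq_eq_sq₀ dist_nonneg dist_nonneg, hd, hd]
      have hp : ∀ x : Plane, o.2.2 * ((x 0 - z 0) ^ 2 + (x 1 - z 1) ^ 2) =
          power o x + (o.1 ^ 2 + o.2.1 ^ 2) / o.2.2 := by
        intro x
        simp [hz, power]
        field_simp
        ring
      rw [← mul_right_inj' h3, hp, hp, add_left_inj]
    refine ⟨z, dist b z, ?_, ?_⟩
    · refine lt_of_le_of_ne dist_nonneg fun h0 => hab ?_
      have h1 := (hdist a b).mpr h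
      rw [← h0] at h1
      rw [dist_eq_zero.mp h1, dist_eq_zero.mp h0.symm]
    · ext x
      rw [Metric.mem_sphere, hdist, Set.mem_ofPred_eq]

/-- Equation of the perpendicular bisector of `a` and `b`. -/
def axis (a b : Plane) : ℝ × ℝ × ℝ :=
  (2 * (b 0 - a 0), 2 * (b 1 - a 1), b 0 ^ 2 + b 1 ^ 2 - (a 0 ^ 2 + a 1 ^ 2))

lemma onLine_axis (a b : Plane) (x : ℝ × ℝ) :
    OnLine (axis a b) x ↔ power (x.1, x.2, 1) a = power (x.1, x.2, 1) b := by
  simp only [OnLine, axis, power]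
  constructor <;> intro h <;> linarith

lemma axis_ne {a b : Plane} (h : a ≠ b) : (axis a b).1 ≠ 0 ∨ (axis a b).2.1 ≠ 0 := by
  by_contra hn
  push Not at hn
  simp only [axis] at hn
  exact h (plane_ext (by linarith) (by linarith))

/-- The direction of the perpendicular bisector of `a` and `b`, as a point at infinity. -/
def axisDir (a b : Plane) : ℝ × ℝ × ℝ := (a 1 - b 1, b 0 - a 0, 0)

lemma axisDir_ne {a b : Plane} (h : a ≠ b) : axisDir a b ≠ 0 := by
  intro h0
  simp only [axisDir, Prod.mk_eq_zero] at h0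
  exact h (plane_ext (by linarith) (by linarith))

/-- Parallel axes are axes concurrent at infinity, so one argument bounds both kinds of pencil. -/
lemma parallel_axis {a b b' : Plane} :
    Parallel (axis a b) (axis a b') ↔ power (axisDir a b) a = power (axisDir a b) b' := by
  simp only [Parallel, axis, power, axisDir]
  constructor <;> intro h <;> linarith

/-- Two points determine the axis, and the other point is the reflection of `a` in it. -/
lemma axis_injective {a b b' : Plane} (hab : a ≠ b) (hab' : a ≠ b') {x y : ℝ × ℝ} (hxy : x ≠ y)
    (h1 : OnLine (axis a b) x) (h2 : OnLine (axis a b) y) (h3 : OnLine (axis a b') x)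
    (h4 : OnLine (axis a b') y) : b = b' := by
  simp only [OnLine, axis] at h1 h2 h3 h4
  obtain ⟨x0, x1⟩ := x
  obtain ⟨y0, y1⟩ := y
  simp only at h1 h2 h3 h4
  set z0 := x0 - y0 with hz0
  set z1 := x1 - y1 with hz1
  have hZ : z0 ^ 2 + z1 ^ 2 ≠ 0 := by
    intro h
    obtain ⟨e0, e1⟩ := eq_zero_of_sq_add_sq h
    exact hxy (Prod.ext (by simp only; linarith) (by simp only; linarith))
  have main : ∀ {b : Plane}, a ≠ b →
      2 * (b 0 - a 0) * x0 + 2 * (b 1 - a 1) * x1 = b 0 ^ 2 + b 1 ^ 2 - (a 0 ^ 2 + a 1 ^ 2) →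
      2 * (b 0 - a 0) * y0 + 2 * (b 1 - a 1) * y1 = b 0 ^ 2 + b 1 ^ 2 - (a 0 ^ 2 + a 1 ^ 2) →
      ∃ t, b 0 = a 0 - t * z1 ∧ b 1 = a 1 + t * z0 ∧
        t * (z0 ^ 2 + z1 ^ 2) = 2 * (-z1 * (x0 - a 0) + z0 * (x1 - a 1)) := by
    intro b hab h1 h2
    have hperp : (b 0 - a 0) * z0 + (b 1 - a 1) * z1 = 0 := by
      rw [hz0, hz1]; linear_combination h1 / 2 - h2 / 2
    refine ⟨((b 1 - a 1) * z0 - (b 0 - a 0) * z1) / (z0 ^ 2 + z1 ^ 2), ?_⟩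
    set t := ((b 1 - a 1) * z0 - (b 0 - a 0) * z1) / (z0 ^ 2 + z1 ^ 2) with ht
    have htZ : t * (z0 ^ 2 + z1 ^ 2) = (b 1 - a 1) * z0 - (b 0 - a 0) * z1 := by
      rw [ht]; field_simp
    have e0 : b 0 = a 0 - t * z1 := by
      apply mul_right_cancel₀ hZ
      linear_combination z0 * hperp + z1 * htZ
    have e1 : b 1 = a 1 + t * z0 := by
      apply mul_right_cancel₀ hZ
      linear_combination z1 * hperp - z0 * htZ
    refine ⟨e0, e1, ?_⟩
    have ht0 : t ≠ 0 := by
      intro h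
      rw [h] at e0 e1
      exact hab (plane_ext (by linarith) (by linarith))
    apply mul_left_cancel₀ ht0
    rw [e0, e1] at h1
    linear_combination -h1
  obtain ⟨t, e0, e1, ht⟩ := main hab h1 h2
  obtain ⟨t', e0', e1', ht'⟩ := main hab' h3 h4
  have : t = t' := mul_right_cancel₀ hZ (ht.trans ht'.symm)
  subst this
  exact plane_ext (by rw [e0, e0']) (by rw [e1, e1'])

lemma onLine_axis_comm (a b : Plane) (x : ℝ × ℝ) :
    OnLine (axis a b) x ↔ OnLine (axis b a) x := by
  rw [onLine_axis, onLine_axis, eq_comm]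

/-- Over the first coordinate `a`, `S_{ac}` contains the circle about `a` through `c` minus `c`,
while `S_{a'c'}` with `a' ≠ a` has at most one point there. Once `a` is known, `c` is the point
missing from the circle. Varieties may thus be counted as pairs. -/
lemma variety_injective {r : ℝ} (hr : r ≠ 0) {a c a' c' : Plane} (h : algDist a c = r)
    (h' : algDist a' c' = r) (hS : variety a c = variety a' c') : a = a' ∧ c = c' := by
  have hac : a ≠ c := by
    rintro rfl
    rw [algDist_eq] at h
    apply hr
    rw [← h]
    ring
  have hmem : ∀ d : Plane, c ≠ d → algDist c a = algDist d a → (a, d) ∈ variety a c :=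
    fun d h1 h2 => Or.inl (Or.inr ⟨rfl, h1, h2⟩)
  have haa : a = a' := by
    by_contra hne
    set d₁ : Plane := !₂[2 * a 0 - c 0, 2 * a 1 - c 1] with hd₁
    set d₂ : Plane := !₂[a 0 - (c 1 - a 1), a 1 + (c 0 - a 0)] with hd₂
    have hN := algDist_pos hac
    have e1 : (a, d₁) ∈ variety a c := by
      apply hmem
      · intro hc
        have e0 := congrArg (fun z : Plane => z 0) hc
        have e1 := congrArg (fun z : Plane => z 1) hc
        simp [hd₁] at e0 e1
        exact hac (plane_ext (by linarith) (by linarith))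
      · simp [algDist_eq, hd₁]
        ring
    have e2 : (a, d₂) ∈ variety a c := by
      apply hmem
      · intro hc
        have e0 := congrArg (fun z : Plane => z 0) hc
        have e1 := congrArg (fun z : Plane => z 1) hc
        simp [hd₂] at e0 e1
        exact hac (plane_ext (by linarith) (by linarith))
      · simp [algDist_eq, hd₂]
        ring
    rw [hS] at e1 e2
    have he := (isReflection_of_mem_variety (Ne.symm hne) e1).unique (Ne.symm hne)
      (isReflection_of_mem_variety (Ne.symm hne) e2)
    have g0 := congrArg (fun z : Plane => z 0) he
    have g1 := congrArg (fun z : Plane => z 1) he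
    simp [hd₁, hd₂] at g0 g1
    exact hac (plane_ext (by linarith) (by linarith))
  refine ⟨haa, ?_⟩
  subst haa
  by_contra hne
  have hself : (a, c) ∉ variety a c := by
    rintro ((⟨h, -⟩ | ⟨-, h, -⟩) | ⟨-, h, -⟩) <;> exact h rfl
  apply hself
  rw [hS]
  refine Or.inl (Or.inr ⟨rfl, Ne.symm hne, ?_⟩)
  rw [algDist_eq] at h h'
  simp only [bisector, Set.mem_ofPred_eq, algDist_eq]
  linarith

/-! ### Counting incidences -/

/-- The incidence of the pair `p` with the variety of the pair `v`, away from rich curves. -/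
structure GoodIncidence (A : Set Plane) (M : ℕ) (p v : Plane × Plane) : Prop where
  ne : v.1 ≠ p.1
  isReflection : IsReflection v.1 p.1 v.2 p.2
  mem : v.1 ∈ A
  not_onRichCurve : ¬ OnRichCurve A M v.1 p.1

lemma GoodIncidence.key_eq {A : Set Plane} {M : ℕ} {p p' v : Plane × Plane}
    (h : GoodIncidence A M p v) (h' : GoodIncidence A M p' v) {o : ℝ × ℝ × ℝ}
    (ho : power o v.1 = power o p.1) (ho' : power o v.1 = power o p'.1) : key o p = key o p' :=
  (h.isReflection.key_eq h.ne ho).trans (h'.isReflection.key_eq h'.ne ho').symm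

lemma GoodIncidence.eq_left {A : Set Plane} {M : ℕ} {p p' v : Plane × Plane}
    (h : GoodIncidence A M p v) (h' : GoodIncidence A M p' v) (h1 : p.1 = p'.1) : p = p' :=
  Prod.ext h1 (h.isReflection.unique h.ne (h1 ▸ h'.isReflection))

lemma GoodIncidence.eq_right {A : Set Plane} {M : ℕ} {p v v' : Plane × Plane}
    (h : GoodIncidence A M p v) (h' : GoodIncidence A M p v') (h1 : v.1 = v'.1) : v = v' :=
  Prod.ext h1 (h.isReflection.symm.unique h.ne.symm (h1 ▸ h'.isReflection.symm))

open Classical in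
/-- The pairs of `P` that arise from `p` by a rotation about `o`. -/
noncomputable def orbit (P : Finset (Plane × Plane)) (o : ℝ × ℝ × ℝ) (p : Plane × Plane) :
    Finset (Plane × Plane) := P.filter (fun p' => key o p' = key o p)

lemma mem_orbit {P : Finset (Plane × Plane)} {o : ℝ × ℝ × ℝ} {p p' : Plane × Plane} :
    p' ∈ orbit P o p ↔ p' ∈ P ∧ key o p' = key o p := by simp [orbit]

/-- Some large orbit through `p` has its centre on the axis of the incidence. -/
def OnRichOrbit (P : Finset (Plane × Plane)) (s : ℕ) (p v : Plane × Plane) : Prop :=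
  ∃ o : ℝ × ℝ × ℝ, o ≠ 0 ∧ power o v.1 = power o p.1 ∧ s ≤ (orbit P o p).card

section

variable {A : Set Plane} {M : ℕ} {r : ℝ} {P : Finset (Plane × Plane)}

/-- Two common members fix the centre up to scaling, and scaling `o` only rescales keys. -/
lemma orbit_eq_orbit {o o' : ℝ × ℝ × ℝ} (hr : r ≠ 0) (hP : ∀ p ∈ P, algDist p.1 p.2 = r)
    (ho : o ≠ 0) (ho' : o' ≠ 0) {p q p₁ p₂ : Plane × Plane} (hne : p₁ ≠ p₂)
    (h1 : p₁ ∈ orbit P o p) (h2 : p₂ ∈ orbit P o p)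
    (h1' : p₁ ∈ orbit P o' q) (h2' : p₂ ∈ orbit P o' q) :
    (∃ t : ℝ, t ≠ 0 ∧ o' = t • o) ∧ orbit P o p = orbit P o' q := by
  rw [mem_orbit] at h1 h2 h1' h2'
  obtain ⟨t, rfl⟩ := exists_smul_of_cross_eq_zero ho
    (eq_of_key_eq hr (hP _ h1.1) (h1.2.trans h2.2.symm) (h1'.2.trans h2'.2.symm) hne)
  have ht : t ≠ 0 := by
    rintro rfl
    simp at ho'
  refine ⟨⟨t, ht, rfl⟩, ?_⟩
  ext x
  rw [mem_orbit, mem_orbit, ← h1.2, ← h1'.2, key_smul, key_smul, (smul_right_injective _ ht).eq_iff]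

/-- All the points `v.1` lie on the line or circle through `p.1` on which `power o` is constant, and
`v.1` with `p` determines `v.2`. This is where the exclusion of rich curves enters. -/
lemma card_axes_through_le {I : Finset ((Plane × Plane) × (Plane × Plane))}
    (hI : ∀ x ∈ I, GoodIncidence A M x.1 x.2) {p : Plane × Plane} {o : ℝ × ℝ × ℝ} (ho : o ≠ 0)
    (h : ∀ x ∈ I, x.1 = p ∧ power o x.2.1 = power o p.1) : I.card ≤ M := by
  classical
  rcases I.eq_empty_or_nonempty with rfl | ⟨x₀, hx₀⟩
  · simp
  have h₀ := hI x₀ hx₀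
  obtain ⟨hp₀, hpow₀⟩ := h x₀ hx₀
  have hne : x₀.2.1 ≠ p.1 := hp₀ ▸ h₀.ne
  have hcard : ({x | power o x = power o p.1} ∩ A).encard ≤ (M : ℕ∞) := by
    by_contra hlt
    push Not at hlt
    apply h₀.not_onRichCurve
    rw [hp₀]
    exact ⟨_, isLine_or_isCircle ho hne hpow₀, hpow₀, rfl, hlt⟩
  have himg : (I.image (fun x => x.2.1)).card = I.card := by
    refine card_image_of_injOn fun x hx y hy hxy => ?_
    have hx' := hI x hx
    have hy' := hI y hy
    rw [(h x hx).1] at hx'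
    rw [(h y hy).1] at hy'
    exact Prod.ext ((h x hx).1.trans (h y hy).1.symm) (hx'.eq_right hy' hxy)
  have hsub : ((I.image (fun x => x.2.1) : Finset Plane) : Set Plane) ⊆
      {x | power o x = power o p.1} ∩ A := by
    intro z hz
    rw [mem_coe, mem_image] at hz
    obtain ⟨x, hx, rfl⟩ := hz
    exact ⟨(h x hx).2, (hI x hx).mem⟩
  have := (Set.encard_le_encard hsub).trans hcard
  rw [Set.encard_coe_eq_coe_finsetCard, himg] at this
  exact_mod_cast this

lemma card_rich_incidences_le (hr : r ≠ 0) (hP : ∀ p ∈ P, algDist p.1 p.2 = r)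
    {I : Finset ((Plane × Plane) × (Plane × Plane))} (hIP : ∀ x ∈ I, x.1 ∈ P)
    (hI : ∀ x ∈ I, GoodIncidence A M x.1 x.2) {s : ℕ} (hs : 2 ≤ s) (hsP : 2 * P.card ≤ s ^ 2)
    (hrich : ∀ x ∈ I, OnRichOrbit P s x.1 x.2) : I.card ≤ M * (2 * P.card) := by
  classical
  choose! o ho0 hopow hos using hrich
  set F : Finset (Finset (Plane × Plane)) := I.image (fun x => orbit P (o x) x.1) with hF
  have hsum : ∑ l ∈ F, l.card ≤ 2 * P.card := by
    refine sum_card_le_of_pairwise_inter P F id ?_ ?_ (s := s) ?_ hsP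
    · intro l hl
      obtain ⟨x, hx, rfl⟩ := mem_image.mp hl
      exact filter_subset _ _
    · intro l hl l' hl' hne
      obtain ⟨x, hx, rfl⟩ := mem_image.mp hl
      obtain ⟨y, hy, rfl⟩ := mem_image.mp hl'
      rw [card_le_one]
      intro p₁ h1 p₂ h2
      simp only [id, mem_inter] at h1 h2
      by_contra h12
      exact hne (orbit_eq_orbit hr hP (ho0 x hx) (ho0 y hy) h12 h1.1 h2.1 h1.2 h2.2).2
    · intro l hl
      obtain ⟨x, hx, rfl⟩ := mem_image.mp hl
      exact hos x hx
  have hself : ∀ x ∈ I, x.1 ∈ orbit P (o x) x.1 := fun x hx => mem_orbit.mpr ⟨hIP x hx, rfl⟩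
  have hfib := card_le_mul_card_image_of_maps_to (s := I)
    (t := F.sigma (fun l => l)) (f := fun x => ⟨orbit P (o x) x.1, x.1⟩)
    (fun x hx => mem_sigma.mpr ⟨mem_image_of_mem _ hx, hself x hx⟩) M ?_
  · rw [card_sigma] at hfib
    exact hfib.trans (Nat.mul_le_mul_left M hsum)
  · rintro ⟨l, p⟩ -
    rcases (I.filter (fun x => (⟨orbit P (o x) x.1, x.1⟩ : Σ _ : Finset (Plane × Plane),
        Plane × Plane) = ⟨l, p⟩)).eq_empty_or_nonempty with h | ⟨x₀, hx₀⟩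
    · rw [h]; simp
    simp only [mem_filter, Sigma.mk.injEq, heq_eq_eq] at hx₀
    obtain ⟨hx₀, hl₀, hp₀⟩ := hx₀
    refine card_axes_through_le (A := A) (p := p) (o := o x₀)
      (fun x hx => hI x (mem_filter.mp hx).1) (ho0 x₀ hx₀) fun x hx => ?_
    simp only [mem_filter, Sigma.mk.injEq, heq_eq_eq] at hx
    obtain ⟨hx, hl, hp⟩ := hx
    refine ⟨hp, ?_⟩
    have hpl : p ∈ orbit P (o x₀) x₀.1 := hp₀ ▸ hself x₀ hx₀
    -- As `s ≥ 2`, the orbit has a second member, so it determines its centre: all incidences in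
    -- this fibre have axes through `o x₀`.
    obtain ⟨q, hq, hqp⟩ := exists_mem_ne
      (show 1 < (orbit P (o x₀) x₀.1).card from lt_of_lt_of_le hs (hos x₀ hx₀)) p
    obtain ⟨⟨t, ht, hto⟩, -⟩ := orbit_eq_orbit hr hP (ho0 x₀ hx₀) (ho0 x hx) hqp hq hpl
      (by rw [hl, ← hl₀]; exact hq) (by rw [hl, ← hl₀]; exact hpl)
    have := hopow x hx
    rw [hto, power_smul, power_smul, hp] at this
    exact mul_left_cancel₀ ht this

/-- The intersection points of the axes of the incidences at `v` that lie on the axis of `p`. -/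
noncomputable def axisVertices (G : Finset (Plane × Plane)) (v p : Plane × Plane) :
    Finset (ℝ × ℝ) := by
  classical
  exact (vertices G (fun q => axis v.1 q.1)).filter (fun x => OnLine (axis v.1 p.1) x)

lemma exists_key_eq_of_mem_axisVertices {G : Finset (Plane × Plane)} {v p : Plane × Plane}
    (hG : ∀ q ∈ G, GoodIncidence A M q v) (hp : p ∈ G) {x : ℝ × ℝ} (hx : x ∈ axisVertices G v p) :
    ∃ q ∈ G, q ≠ p ∧ key (x.1, x.2, 1) p = key (x.1, x.2, 1) q := by
  classical
  simp only [axisVertices, vertices, mem_filter, mem_image, mem_product] at hx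
  obtain ⟨⟨⟨q₁, q₂⟩, ⟨⟨h1, h2⟩, hpar⟩, rfl⟩, hon⟩ := hx
  obtain ⟨hon1, hon2⟩ := onLine_meet hpar
  simp only at h1 h2 hpar hon hon1 hon2
  rw [onLine_axis] at hon hon1 hon2
  by_cases hq : q₁ = p
  · refine ⟨q₂, h2, ?_, (hG p hp).key_eq (hG q₂ h2) hon hon2⟩
    rintro rfl
    exact hpar (by rw [hq]; rfl)
  · exact ⟨q₁, h1, hq, (hG p hp).key_eq (hG q₁ h1) hon hon1⟩

lemma sum_axisVertices_le (hr : r ≠ 0) (hP : ∀ p ∈ P, algDist p.1 p.2 = r)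
    {G : Plane × Plane → Finset (Plane × Plane)} (hGP : ∀ v, G v ⊆ P)
    (hG : ∀ v, ∀ q ∈ G v, GoodIncidence A M q v) {s : ℕ} (hsP : 2 * P.card ≤ s ^ 2)
    {p : Plane × Plane} (W : Finset (Plane × Plane))
    (hW : ∀ v ∈ W, p ∈ G v ∧ s ≤ (axisVertices (G v) v p).card) :
    ∑ v ∈ W, (axisVertices (G v) v p).card ≤ 2 * P.card := by
  classical
  -- `z q` is the only finite centre of a rotation taking `p` to `q`, or `0` if there is none; so
  -- the image of `P` under `z` contains all vertices on axes of `p`.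
  have hex : ∀ q : Plane × Plane, ∃ z : ℝ × ℝ, ∀ x : ℝ × ℝ, q ≠ p → p ∈ P →
      key (x.1, x.2, 1) p = key (x.1, x.2, 1) q → x = z := by
    intro q
    by_cases h : ∃ z : ℝ × ℝ, key (z.1, z.2, 1) p = key (z.1, z.2, 1) q
    · obtain ⟨z, hz⟩ := h
      refine ⟨z, fun x hqp hp hx => ?_⟩
      have := eq_of_key_eq hr (hP p hp) hx hz hqp.symm
      simp only at this
      exact Prod.ext (by linarith) (by linarith)
    · exact ⟨0, fun x _ _ hx => absurd ⟨x, hx⟩ h⟩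
  choose z hz using hex
  have hU : (P.image z).card ≤ P.card := card_image_le
  refine (sum_card_le_of_pairwise_inter (P.image z) W (fun v => axisVertices (G v) v p)
    ?_ ?_ (fun v hv => (hW v hv).2) (by omega)).trans (by omega)
  · intro v hv x hx
    obtain ⟨hp, -⟩ := hW v hv
    obtain ⟨q, hq, hqp, hkey⟩ := exists_key_eq_of_mem_axisVertices (hG v) hp hx
    rw [hz q x hqp (hGP v hp) hkey]
    exact mem_image_of_mem _ (hGP v hq)
  · intro v hv v' hv' hne
    rw [card_le_one]
    intro x hx y hy
    simp only [mem_inter, axisVertices, mem_filter] at hx hy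
    by_contra hxy
    have h := hG v p (hW v hv).1
    have h' := hG v' p (hW v' hv').1
    apply hne
    apply h.eq_right h'
    exact axis_injective h.ne.symm h'.ne.symm hxy
      ((onLine_axis_comm _ _ _).mp hx.1.2) ((onLine_axis_comm _ _ _).mp hy.1.2)
      ((onLine_axis_comm _ _ _).mp hx.2.2) ((onLine_axis_comm _ _ _).mp hy.2.2)

/-- More than `s` axes through one point, finite or infinite, would put their pairs in one rich
orbit; so the Beck-type bound applies. -/
lemma sq_card_le_sum_axisVertices {G : Finset (Plane × Plane)} {v : Plane × Plane} (hGP : G ⊆ P)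
    (hG : ∀ q ∈ G, GoodIncidence A M q v) {s : ℕ} (hs : 1 ≤ s)
    (hpoor : ∀ q ∈ G, ¬ OnRichOrbit P s q v) (hbig : 300000 * s ≤ G.card) :
    G.card ^ 2 ≤ 120000 * ∑ p ∈ G, (axisVertices G v p).card := by
  classical
  have hclass : ∀ o : ℝ × ℝ × ℝ, o ≠ 0 →
      (G.filter (fun q => power o v.1 = power o q.1)).card ≤ s := by
    intro o ho
    rcases (G.filter (fun q => power o v.1 = power o q.1)).eq_empty_or_nonempty with h | ⟨q, hq⟩
    · simp [h]
    rw [mem_filter] at hq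
    by_contra hlt
    push Not at hlt
    refine hpoor q hq.1 ⟨o, ho, hq.2, hlt.le.trans (card_le_card fun q' hq' => ?_)⟩
    rw [mem_filter] at hq'
    exact mem_orbit.mpr ⟨hGP hq'.1, (hG q' hq'.1).key_eq (hG q hq.1) hq'.2 hq.2⟩
  refine sq_card_le_mul_sum_degree (fun q hq => axis_ne (hG q hq).ne) ?_ hs ?_ ?_ hbig
  · intro q hq q' hq' hne x y h1 h2 h3 h4
    by_contra hxy
    exact hne ((hG q hq).eq_left (hG q' hq')
      (axis_injective (hG q hq).ne (hG q' hq').ne hxy h1 h2 h3 h4))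
  · intro x
    simp only [degree, onLine_axis]
    exact hclass _ (by simp)
  · intro q hq
    simp only [parallel_axis]
    exact hclass _ (axisDir_ne (hG q hq).ne)

lemma card_poor_incidences_le (hr : r ≠ 0) (hP : ∀ p ∈ P, algDist p.1 p.2 = r)
    {W : Finset (Plane × Plane)} {I : Finset ((Plane × Plane) × (Plane × Plane))}
    (hIP : ∀ x ∈ I, x.1 ∈ P) (hIW : ∀ x ∈ I, x.2 ∈ W)
    (hI : ∀ x ∈ I, GoodIncidence A M x.1 x.2) {s : ℕ} (hs : 1 ≤ s) (hsP : 2 * P.card ≤ s ^ 2)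
    (hpoor : ∀ x ∈ I, ¬ OnRichOrbit P s x.1 x.2) :
    I.card ≤ 300000 * s * W.card + P.card * s := by
  classical
  set G : Plane × Plane → Finset (Plane × Plane) := fun v => P.filter (fun p => (p, v) ∈ I) with hG
  have hGP : ∀ v, G v ⊆ P := fun v => filter_subset _ _
  have hGI : ∀ v, ∀ q ∈ G v, (q, v) ∈ I := fun v q hq => (mem_filter.mp hq).2
  have hGood : ∀ v, ∀ q ∈ G v, GoodIncidence A M q v := fun v q hq => hI _ (hGI v q hq)
  have hcard : I.card = ∑ v ∈ W, (G v).card := by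
    rw [card_eq_sum_card_fiberwise (f := fun x => x.2) (t := W) (fun x hx => hIW x hx)]
    refine sum_congr rfl fun v _ => ?_
    refine (card_bij (fun q _ => (q, v)) ?_ ?_ ?_).symm
    · intro q hq
      exact mem_filter.mpr ⟨hGI v q hq, rfl⟩
    · intro q _ q' _ h
      exact (Prod.mk.inj h).1
    · rintro ⟨q, v'⟩ hx
      obtain ⟨hxI, hv⟩ := mem_filter.mp hx
      simp only at hv
      subst hv
      exact ⟨q, mem_filter.mpr ⟨hIP _ hxI, hxI⟩, rfl⟩
  set B := W.filter (fun v => 300000 * s ≤ (G v).card) with hB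
  set δ : Plane × Plane → Plane × Plane → ℕ := fun v p => (axisVertices (G v) v p).card with hδ
  have hrichsum : ∑ v ∈ B, ∑ p ∈ G v, (if s ≤ δ v p then δ v p else 0) ≤
      P.card * (2 * P.card) := by
    have h1 : ∀ v ∈ B, ∑ p ∈ G v, (if s ≤ δ v p then δ v p else 0) =
        ∑ p ∈ P, (if p ∈ G v ∧ s ≤ δ v p then δ v p else 0) := by
      intro v _
      rw [← inter_eq_right.mpr (hGP v), ← filter_mem_eq_inter, sum_filter,
        filter_mem_eq_inter, inter_eq_right.mpr (hGP v)]
      refine sum_congr rfl fun p _ => ?_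
      by_cases h : p ∈ G v <;> simp [h]
    rw [sum_congr rfl h1, sum_comm, ← smul_eq_mul]
    refine sum_le_card_nsmul _ _ _ fun p _ => ?_
    rw [← sum_filter]
    exact sum_axisVertices_le hr hP hGP hGood hsP _ fun v hv => (mem_filter.mp hv).2
  -- Axes with fewer than `s` vertices contribute at most `|G v| s ≤ |G v|² / 300000`, so dropping
  -- them costs at most a factor `2`.
  have hbig : ∀ v ∈ B, (G v).card ^ 2 ≤
      240000 * ∑ p ∈ G v, (if s ≤ δ v p then δ v p else 0) := by
    intro v hv
    have hv' := (mem_filter.mp hv).2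
    have h1 := sq_card_le_sum_axisVertices (hGP v) (hGood v) hs
      (fun q hq => hpoor _ (hGI v q hq)) hv'
    have h2 : ∑ p ∈ G v, δ v p ≤ (G v).card * s +
        ∑ p ∈ G v, (if s ≤ δ v p then δ v p else 0) := by
      rw [← smul_eq_mul, ← sum_const, ← sum_add_distrib]
      refine sum_le_sum fun p _ => ?_
      split_ifs <;> omega
    have h3 : 300000 * ((G v).card * s) ≤ (G v).card ^ 2 := by
      rw [pow_two]
      calc 300000 * ((G v).card * s) = (G v).card * (300000 * s) := by ring
        _ ≤ _ := Nat.mul_le_mul_left _ hv'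
    simp only [hδ] at h2 ⊢
    omega
  have hsumB : ∑ v ∈ B, (G v).card ≤ P.card * s := by
    have h1 : 300000 * s * ∑ v ∈ B, (G v).card ≤ 240000 * (P.card * (2 * P.card)) := by
      calc 300000 * s * ∑ v ∈ B, (G v).card ≤ ∑ v ∈ B, (G v).card ^ 2 := by
            rw [mul_sum]
            refine sum_le_sum fun v hv => ?_
            rw [pow_two]
            exact Nat.mul_le_mul_right _ (mem_filter.mp hv).2
        _ ≤ ∑ v ∈ B, 240000 * ∑ p ∈ G v, (if s ≤ δ v p then δ v p else 0) :=
            sum_le_sum hbig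
        _ ≤ _ := by
            rw [← mul_sum]
            exact Nat.mul_le_mul_left _ hrichsum
    refine Nat.le_of_mul_le_mul_right ?_ (show 0 < s by omega)
    have h2 : P.card * (2 * P.card) ≤ P.card * s * s := by
      calc P.card * (2 * P.card) ≤ P.card * s ^ 2 := Nat.mul_le_mul_left _ hsP
        _ = _ := by ring
    have h3 : 300000 * ((∑ v ∈ B, (G v).card) * s) = 300000 * s * ∑ v ∈ B, (G v).card := by ring
    omega
  have hsumS : ∑ v ∈ W.filter (fun v => ¬ 300000 * s ≤ (G v).card), (G v).card ≤
      300000 * s * W.card := by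
    calc ∑ v ∈ W.filter (fun v => ¬ 300000 * s ≤ (G v).card), (G v).card
        ≤ (W.filter (fun v => ¬ 300000 * s ≤ (G v).card)).card • (300000 * s) :=
          sum_le_card_nsmul _ _ _ fun v hv => (not_le.mp (mem_filter.mp hv).2).le
      _ ≤ _ := by
          rw [smul_eq_mul, mul_comm]
          exact Nat.mul_le_mul_left _ (card_filter_le _ _)
  rw [hcard, ← sum_filter_add_sum_filter_not W (fun v => 300000 * s ≤ (G v).card)]
  exact (Nat.add_le_add hsumB hsumS).trans (Nat.add_comm _ _).le

lemma card_incidences_le (hr : r ≠ 0) (hP : ∀ p ∈ P, algDist p.1 p.2 = r)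
    {W : Finset (Plane × Plane)} {I : Finset ((Plane × Plane) × (Plane × Plane))}
    (hIP : ∀ x ∈ I, x.1 ∈ P) (hIW : ∀ x ∈ I, x.2 ∈ W)
    (hI : ∀ x ∈ I, GoodIncidence A M x.1 x.2) {s : ℕ} (hs : 2 ≤ s) (hsP : 2 * P.card ≤ s ^ 2) :
    I.card ≤ M * (2 * P.card) + (300000 * s * W.card + P.card * s) := by
  classical
  rw [← card_filter_add_card_filter_not (s := I) (fun x => OnRichOrbit P s x.1 x.2)]
  refine Nat.add_le_add ?_ ?_
  · exact card_rich_incidences_le hr hP (fun x hx => hIP x (mem_filter.mp hx).1)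
      (fun x hx => hI x (mem_filter.mp hx).1) hs hsP (fun x hx => (mem_filter.mp hx).2)
  · exact card_poor_incidences_le hr hP (fun x hx => hIP x (mem_filter.mp hx).1)
      (fun x hx => hIW x (mem_filter.mp hx).1) (fun x hx => hI x (mem_filter.mp hx).1)
      (by omega) hsP (fun x hx => (mem_filter.mp hx).2)

lemma incidenceCount_le (hr : r ≠ 0) (hP : (P : Set (Plane × Plane)) ⊆ pairsAt A r)
    {V : Finset (Set (Plane × Plane))} (hV : (V : Set (Set (Plane × Plane))) ⊆ varietiesAt A r)
    {s : ℕ} (hs : 2 ≤ s) (hsP : 2 * P.card ≤ s ^ 2) :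
    incidenceCount A r M P V ≤ M * (2 * P.card) + (300000 * s * V.card + P.card * s) := by
  classical
  have hrep : ∀ S ∈ V, ∃ v : Plane × Plane, algDist v.1 v.2 = r ∧ S = variety v.1 v.2 := by
    intro S hS
    obtain ⟨a, -, c, -, h, h'⟩ := hV hS
    exact ⟨(a, c), h, h'⟩
  choose! ρ hρr hρ using hrep
  set I : Finset ((Plane × Plane) × (Plane × Plane)) :=
    (P ×ˢ V.image ρ).filter (fun x => GoodIncidence A M x.1 x.2) with hI
  have hle : incidenceCount A r M P V ≤ I.card := by
    rw [incidenceCount, ← Set.ncard_coe_finset]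
    refine Set.ncard_le_ncard_of_injOn (fun i => (i.1, ρ i.2)) ?_ ?_ (finite_toSet I)
    · rintro ⟨p, S⟩ ⟨hp, hS, hmem, a, ha, c, -, hac, hSac, hne, hcurve⟩
      simp only at hp hS hmem hSac hne hcurve
      obtain ⟨h1, h2⟩ := variety_injective hr (hρr S hS) hac ((hρ S hS).symm.trans hSac)
      rw [mem_coe, mem_filter, mem_product]
      refine ⟨⟨hp, mem_image_of_mem _ hS⟩, ?_, ?_, ?_, ?_⟩
      · simpa only [h1] using hne
      · simp only [h1, h2]
        exact isReflection_of_mem_variety hne (hSac ▸ hmem)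
      · simpa only [h1] using ha
      · simpa only [h1] using hcurve
    · rintro ⟨p, S⟩ hS ⟨p', S'⟩ hS' h
      simp only [Prod.mk.injEq] at h
      have h1 := hρ S hS.2.1
      have h2 := hρ S' hS'.2.1
      rw [h.2, ← h2] at h1
      exact Prod.ext h.1 h1
  have hmain := card_incidences_le (W := V.image ρ) (I := I) (A := A) (M := M) hr
    (fun p hp => (hP hp).2.2) (fun x hx => (mem_product.mp (mem_filter.mp hx).1).1)
    (fun x hx => (mem_product.mp (mem_filter.mp hx).1).2) (fun x hx => (mem_filter.mp hx).2) hs hsP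
  have hW : 300000 * s * (V.image ρ).card ≤ 300000 * s * V.card :=
    Nat.mul_le_mul_left _ card_image_le
  omega

end

end BisectorIncidence

theorem mainTheorem8 :
    ∃ C : ℝ, 0 < C ∧
      ∀ (A : Set BisectorIncidence.Plane) (r : ℝ) (M : ℕ)
        (P : Finset (BisectorIncidence.Plane × BisectorIncidence.Plane))
        (V : Finset (Set (BisectorIncidence.Plane × BisectorIncidence.Plane))),
        r ≠ 0 →
        (P : Set (BisectorIncidence.Plane × BisectorIncidence.Plane)) ⊆
          BisectorIncidence.pairsAt A r →
        (V : Set (Set (BisectorIncidence.Plane × BisectorIncidence.Plane))) ⊆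
          BisectorIncidence.varietiesAt A r →
        (BisectorIncidence.incidenceCount A r M P V : ℝ) ≤
          C * ((M : ℝ) * (P.card : ℝ) + (P.card : ℝ) ^ (3 / 2 : ℝ) +
            (P.card : ℝ) ^ (1 / 2 : ℝ) * (V.card : ℝ)) := by
  -- `900000 = 3 · 300000`, from `s ≤ 3 |P|^{1/2}` below; that bound needs `P` nonempty.
  refine ⟨900000, by norm_num, fun A r M P V hr hP hV => ?_⟩
  rcases Nat.eq_zero_or_pos P.card with h0 | hpos
  · have : BisectorIncidence.incidenceCount A r M P V = 0 := by
      have hempty : BisectorIncidence.incidences A r M P V = ∅ := by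
        ext i
        simp [BisectorIncidence.incidences, Finset.card_eq_zero.mp h0]
      rw [BisectorIncidence.incidenceCount, hempty, Set.ncard_empty]
    rw [this, Nat.cast_zero]
    positivity
  · have hs1 : 1 ≤ Nat.sqrt (2 * P.card) := by
      rw [Nat.le_sqrt]; omega
    -- The `+ 1` after the integer square root ensures `2|P| ≤ s²`.
    have hmain := BisectorIncidence.incidenceCount_le (M := M) hr hP hV
      (s := Nat.sqrt (2 * P.card) + 1) (by omega) (by
        rw [pow_two]; exact (Nat.lt_succ_sqrt _).le)
    have hn : (1 : ℝ) ≤ P.card := by exact_mod_cast hpos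
    have hroot : (P.card : ℝ) ^ (1 / 2 : ℝ) = √(P.card : ℝ) := (Real.sqrt_eq_rpow _).symm
    have hroot3 : (P.card : ℝ) ^ (3 / 2 : ℝ) = P.card * √(P.card : ℝ) := by
      rw [show (3 / 2 : ℝ) = 1 + 1 / 2 by norm_num, Real.rpow_add (by linarith), Real.rpow_one,
        hroot]
    have hsq : √(P.card : ℝ) * √(P.card : ℝ) = P.card := Real.mul_self_sqrt (by linarith)
    have hsq1 : 1 ≤ √(P.card : ℝ) := Real.one_le_sqrt.mpr hn
    have hs : ((Nat.sqrt (2 * P.card) + 1 : ℕ) : ℝ) ≤ 3 * √(P.card : ℝ) := by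
      have h1 : (Nat.sqrt (2 * P.card) : ℝ) * Nat.sqrt (2 * P.card) ≤ 2 * P.card := by
        exact_mod_cast Nat.sqrt_le _
      have h2 : (Nat.sqrt (2 * P.card) : ℝ) ≤ 2 * √(P.card : ℝ) := by
        refine abs_le_of_sq_le_sq' ?_ (by positivity) |>.2
        nlinarith
      push_cast
      linarith
    rw [hroot, hroot3]
    have hmain' : (BisectorIncidence.incidenceCount A r M P V : ℝ) ≤
        M * (2 * P.card) + (300000 * ((Nat.sqrt (2 * P.card) + 1 : ℕ) : ℝ) * V.card +
          P.card * ((Nat.sqrt (2 * P.card) + 1 : ℕ) : ℝ)) := by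
      exact_mod_cast hmain
    have h1 : ((Nat.sqrt (2 * P.card) + 1 : ℕ) : ℝ) * V.card ≤ 3 * √(P.card : ℝ) * V.card :=
      mul_le_mul_of_nonneg_right hs (by positivity)
    have h2 : (P.card : ℝ) * ((Nat.sqrt (2 * P.card) + 1 : ℕ) : ℝ) ≤
        P.card * (3 * √(P.card : ℝ)) := mul_le_mul_of_nonneg_left hs (by positivity)
    have h3 : (0 : ℝ) ≤ M * P.card := by positivity
    have h4 : (0 : ℝ) ≤ P.card * √(P.card : ℝ) := by positivity
    linarith
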